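/- **Theorem (Harnack inequality and its Hölder consequence).** Notation. Let $n\ge 1$ and write points of $\mathbb R^{n}\times\mathbb R$ as $(x,t)$, with $x_n$ the last coordinate of $x$. Put $Q_r(x_0,t_0)=B_r(x_0)\times(t_0-r^2,t_0]$, $Q_r=Q_r(0,0)$, and $d_p((x,t),(y,s))=(|x-y|^2+|t-s|)^{1/2}$. For a function $v$ on $Q=Q_1$ put $v^\pm=\max(\pm v,0)$, $Q^\pm(v)=\{\pm v>0\}\cap Q$ and $F(v)=\{v=0\}\cap Q$. $C^2$ is meant in the parabolic sense: $v,\nabla v,D^2v$ (in $x$) and $v_t$ are continuous (on a closure: they extend continuously to it); time derivatives at the final time are left derivatives. A function $v$ touches $u$ from above (below) at $p\in Q$ if $u(p)=v(p)$ and $u\le v$ ($u\ge v$) on some $Q_\rho(p)\subset Q$, $\rho>0$. Let $a_+,a_->0$, $a_+\ne a_-$. A function $u\in C(Q)$ is a *viscosity subsolution* (resp. *supersolution*) in $Q$ of $$a_\pm u_t-\Delta u=0\ \text{ in }\{\pm u>0\},\qquad \partial_\nu u^+=\partial_\nu u^-\ \text{ on }\{u=0\}$$ if: (i) whenever $v\in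 C^2(Q^+(u))$ touches $u$ from above (resp. below) at $p\in Q^+(u)$, then $a_+v_t(p)-\Delta v(p)\le0$ (resp. $\ge0$); (ii) the same with $Q^-(u)$ and $a_-$ in place of $Q^+(u)$ and $a_+$; (iii) whenever $v\in C(Q)\cap C^2(\overline{Q^+(v)})\cap C^2(\overline{Q^-(v)})$ touches $u$ from above (resp. below) at $p\in F(u)\cap F(v)$, $p$ lies in $\overline{Q^+(v)}\cap\overline{Q^-(v)}$, and $\partial_\nu v^\pm(p)>0$, then $\partial_\nu v^-(p)-\partial_\nu v^+(p)\le0$ (resp. $\ge0$). Here $\partial_\nu v^\pm(p)=|\nabla v^\pm(p)|$ is the derivative in the inward normal direction to $\{\pm v>0\}$, with $\nabla v^\pm(p)=\lim\nabla v^\pm(q)$ as $q\to p$, $q\in Q^\pm(v)$. A *viscosity solution* is both a subsolution and a supersolution. Claim. There is a universal constant $\delta_0>0$ such that, for all such $n$, $a_+$, $a_-$: (a) There is $\bar c\in(0,1)$, depending only on $n,a_+,a_-$, such that the following holds. Let $u$ be a viscosity solution in $Q_1$, let $(x_0,t_0)\in Q_{1/2}$, $r>0$, $Q_r(x_0,t_0)\subset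 Q_1$, and suppose $$x_n+\alpha_0\le u(x,t)\le x_n+\beta_0\quad\text{in }Q_r(x_0,t_0),$$ with $0<\beta_0-\alpha_0\le\delta r$ and $0<\delta\le\delta_0$. Then there are $\alpha_1,\beta_1\in\mathbb R$ with $\alpha_0\le\alpha_1\le\beta_1\le\beta_0$ and $\beta_1-\alpha_1\le\bar c\,\delta r$ such that $$x_n+\alpha_1\le u(x,t)\le x_n+\beta_1\quad\text{in }Q_{r/3}(x_0,t_0).$$ (b) There are $C>0$ and $\gamma\in(0,1)$, depending only on $n,a_+,a_-$, such that if $u$ is a viscosity solution in $Q_1$ with $x_n-\delta\le u\le x_n+\delta$ in $Q_1$ for some $0<\delta\le\delta_0/4$, then $u_\delta=(u-x_n)/\delta$ satisfies $$|u_\delta(x,t)-u_\delta(x_0,t_0)|\le C\,d_p((x,t),(x_0,t_0))^\gamma$$ for all $(x_0,t_0)\in Q_{1/2}$ and all $(x,t)\in Q_{1/2}(x_0,t_0)$ with $d_p((x,t),(x_0,t_0))\ge 2\delta/\delta_0$. -/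

import Mathlib

open Set Filter Topology

noncomputable section

namespace FreeTransmission

/-- Space-time `ℝⁿ × ℝ`; a point is `p = (x, t)` with `x` in Euclidean `ℝⁿ`. -/
abbrev SpaceTime (n : ℕ) : Type := EuclideanSpace ℝ (Fin n) × ℝ

/-- The backward parabolic cylinder `Q_r(x₀, t₀) = B_r(x₀) × (t₀ - r², t₀]`. -/
def cyl {n : ℕ} (x₀ : EuclideanSpace ℝ (Fin n)) (t₀ r : ℝ) : Set (SpaceTime n) :=
  Metric.ball x₀ r ×ˢ Ioc (t₀ - r ^ 2) t₀

/-- The parabolic distance `(|x - y|² + |t - s|)^{1/2}`. -/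
def parabolicDist {n : ℕ} (p q : SpaceTime n) : ℝ :=
  Real.sqrt (‖p.1 - q.1‖ ^ 2 + |p.2 - q.2|)

variable {n : ℕ}

/-- The positive phase `{u > 0} ∩ Q`. -/
def posPhase (Q : Set (SpaceTime n)) (u : SpaceTime n → ℝ) : Set (SpaceTime n) :=
  Q ∩ {p | 0 < u p}

/-- The negative phase `{u < 0} ∩ Q`. -/
def negPhase (Q : Set (SpaceTime n)) (u : SpaceTime n → ℝ) : Set (SpaceTime n) :=
  Q ∩ {p | u p < 0}

/-- The free boundary `{u = 0} ∩ Q`. -/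
def freeBoundary (Q : Set (SpaceTime n)) (u : SpaceTime n → ℝ) : Set (SpaceTime n) :=
  Q ∩ {p | u p = 0}

/-- The spatial gradient of `v` at `p`. -/
def spaceGrad (v : SpaceTime n → ℝ) (p : SpaceTime n) : EuclideanSpace ℝ (Fin n) :=
  gradient (fun y => v (y, p.2)) p.1

/-- The spatial second derivative of `v` at `p`. -/
def spaceHess (v : SpaceTime n → ℝ) (p : SpaceTime n) :
    ContinuousMultilinearMap ℝ (fun _ : Fin 2 => EuclideanSpace ℝ (Fin n)) ℝ :=
  iteratedFDeriv ℝ 2 (fun y => v (y, p.2)) p.1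

/-- The spatial Laplacian of `v` at `p`. -/
def spaceLaplacian (v : SpaceTime n → ℝ) (p : SpaceTime n) : ℝ :=
  Laplacian.laplacian (fun y => v (y, p.2)) p.1

/-- The times `s` with `(x, s) ∈ S`. -/
def timeSlice (S : Set (SpaceTime n)) (x : EuclideanSpace ℝ (Fin n)) : Set ℝ :=
  {s | (x, s) ∈ S}

/-- The time derivative of `v` at `p`, taken inside `S`. When `S` is relatively open in a cylinder
`Ω × (t₁, t₂]` this is the usual derivative for `t < t₂` and the left derivative for `t = t₂`. -/
def timeDeriv (S : Set (SpaceTime n)) (v : SpaceTime n → ℝ) (p : SpaceTime n) : ℝ :=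
  derivWithin (fun s => v (p.1, s)) (timeSlice S p.1) p.2

/-- `v ∈ C²(S)` in the parabolic sense: `v`, `∇v`, `D²v` and `v_t` exist and are continuous on `S`.
It is used for sets `S` that are relatively open in a cylinder `Ω × (t₁, t₂]`. -/
structure ParabolicC2On (v : SpaceTime n → ℝ) (S : Set (SpaceTime n)) : Prop where
  contDiff_space : ∀ p ∈ S, ContDiffAt ℝ 2 (fun y => v (y, p.2)) p.1
  diff_time : ∀ p ∈ S, DifferentiableWithinAt ℝ (fun s => v (p.1, s)) (timeSlice S p.1) p.2
  continuousOn : ContinuousOn v S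
  continuousOn_grad : ContinuousOn (spaceGrad v) S
  continuousOn_hess : ContinuousOn (spaceHess v) S
  continuousOn_time : ContinuousOn (timeDeriv S v) S

/-- `f`, given on `S`, extends continuously to the closure of `S`. -/
def ExtendsToClosure {F : Type*} [TopologicalSpace F] (f : SpaceTime n → F)
    (S : Set (SpaceTime n)) : Prop :=
  ∃ g : SpaceTime n → F, ContinuousOn g (closure S) ∧ EqOn g f S

/-- `v ∈ C²` on the closure of `S` in the parabolic sense: `v ∈ C²(S)`, and `v`, `∇v`, `D²v`, `v_t`
extend continuously from `S` to its closure. -/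
structure ParabolicC2OnClosure (v : SpaceTime n → ℝ) (S : Set (SpaceTime n)) : Prop where
  c2On : ParabolicC2On v S
  extends_self : ExtendsToClosure v S
  extends_grad : ExtendsToClosure (spaceGrad v) S
  extends_hess : ExtendsToClosure (spaceHess v) S
  extends_time : ExtendsToClosure (timeDeriv S v) S

/-- `v` touches `u` from above at `p`, within the set `Q`. -/
def TouchesFromAbove (Q : Set (SpaceTime n)) (v u : SpaceTime n → ℝ) (p : SpaceTime n) : Prop :=
  u p = v p ∧ ∃ r : ℝ, 0 < r ∧ cyl p.1 p.2 r ⊆ Q ∧ ∀ q ∈ cyl p.1 p.2 r, u q ≤ v q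

/-- `v` touches `u` from below at `p`, within the set `Q`. -/
def TouchesFromBelow (Q : Set (SpaceTime n)) (v u : SpaceTime n → ℝ) (p : SpaceTime n) : Prop :=
  u p = v p ∧ ∃ r : ℝ, 0 < r ∧ cyl p.1 p.2 r ⊆ Q ∧ ∀ q ∈ cyl p.1 p.2 r, v q ≤ u q

/-- `v⁺ = max(v, 0)`. -/
def posFun (v : SpaceTime n → ℝ) : SpaceTime n → ℝ := fun p => max (v p) 0

/-- `v⁻ = max(-v, 0)`. -/
def negFun (v : SpaceTime n → ℝ) : SpaceTime n → ℝ := fun p => max (-v p) 0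

/-- For `w ≥ 0`, `m` is the normal derivative `∂_ν w` at `p` in the inward direction to `{w > 0}`:
`p` is a limit point of `{w > 0}` (in `Q`), the limit of `∇w` at `p` from inside `{w > 0}` exists,
and `m` is its norm. -/
def HasInwardNormalDeriv (Q : Set (SpaceTime n)) (w : SpaceTime n → ℝ) (p : SpaceTime n)
    (m : ℝ) : Prop :=
  p ∈ closure (posPhase Q w) ∧
    ∃ g : EuclideanSpace ℝ (Fin n), Tendsto (spaceGrad w) (𝓝[posPhase Q w] p) (𝓝 g) ∧ m = ‖g‖

/-- Viscosity subsolutions in `Q` of the free transmission problem `a₊ u_t - Δu = 0` in `{u > 0}`,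
`a₋ u_t - Δu = 0` in `{u < 0}`, `∂_ν u⁺ = ∂_ν u⁻` on `{u = 0}`. -/
structure IsViscositySubsolution (aPos aNeg : ℝ) (Q : Set (SpaceTime n))
    (u : SpaceTime n → ℝ) : Prop where
  continuousOn : ContinuousOn u Q
  pos : ∀ (v : SpaceTime n → ℝ) (p : SpaceTime n), p ∈ posPhase Q u →
    ParabolicC2On v (posPhase Q u) → TouchesFromAbove Q v u p →
    aPos * timeDeriv (posPhase Q u) v p - spaceLaplacian v p ≤ 0
  neg : ∀ (v : SpaceTime n → ℝ) (p : SpaceTime n), p ∈ negPhase Q u →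
    ParabolicC2On v (negPhase Q u) → TouchesFromAbove Q v u p →
    aNeg * timeDeriv (negPhase Q u) v p - spaceLaplacian v p ≤ 0
  transmission : ∀ (v : SpaceTime n → ℝ) (p : SpaceTime n) (mPos mNeg : ℝ),
    p ∈ freeBoundary Q u → p ∈ freeBoundary Q v → ContinuousOn v Q →
    ParabolicC2OnClosure v (posPhase Q v) → ParabolicC2OnClosure v (negPhase Q v) →
    TouchesFromAbove Q v u p →
    HasInwardNormalDeriv Q (posFun v) p mPos → HasInwardNormalDeriv Q (negFun v) p mNeg →
    0 < mPos → 0 < mNeg → mNeg - mPos ≤ 0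

/-- Viscosity supersolutions in `Q` of the same free transmission problem. -/
structure IsViscositySupersolution (aPos aNeg : ℝ) (Q : Set (SpaceTime n))
    (u : SpaceTime n → ℝ) : Prop where
  continuousOn : ContinuousOn u Q
  pos : ∀ (v : SpaceTime n → ℝ) (p : SpaceTime n), p ∈ posPhase Q u →
    ParabolicC2On v (posPhase Q u) → TouchesFromBelow Q v u p →
    0 ≤ aPos * timeDeriv (posPhase Q u) v p - spaceLaplacian v p
  neg : ∀ (v : SpaceTime n → ℝ) (p : SpaceTime n), p ∈ negPhase Q u →
    ParabolicC2On v (negPhase Q u) → TouchesFromBelow Q v u p →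
    0 ≤ aNeg * timeDeriv (negPhase Q u) v p - spaceLaplacian v p
  transmission : ∀ (v : SpaceTime n → ℝ) (p : SpaceTime n) (mPos mNeg : ℝ),
    p ∈ freeBoundary Q u → p ∈ freeBoundary Q v → ContinuousOn v Q →
    ParabolicC2OnClosure v (posPhase Q v) → ParabolicC2OnClosure v (negPhase Q v) →
    TouchesFromBelow Q v u p →
    HasInwardNormalDeriv Q (posFun v) p mPos → HasInwardNormalDeriv Q (negFun v) p mNeg →
    0 < mPos → 0 < mNeg → 0 ≤ mNeg - mPos

/-- Viscosity solutions: both sub- and supersolutions. -/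
def IsViscositySolution (aPos aNeg : ℝ) (Q : Set (SpaceTime n)) (u : SpaceTime n → ℝ) : Prop :=
  IsViscositySubsolution aPos aNeg Q u ∧ IsViscositySupersolution aPos aNeg Q u

/-- The last coordinate of the space variable, in dimension `n + 1`. -/
def lastCoord (p : SpaceTime (n + 1)) : ℝ := p.1 (Fin.last n)

end FreeTransmission

end

/-! Put `h = β₀ - α₀` and measure the height of `u` over `x_n + α₀` in units of `h`: it lies between
0 and 1, and has to be kept away from 0 or from 1 in the smaller cylinder. The flatness `h ≤ r/100`
forces `u` to have one sign on the ball of radius `r/20` about one of the points `x₀ ± (r/10) e_n`,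
at all times of the cylinder, so that `u` solves an ordinary heat equation there. Consider a
weighted mean of the height over that ball at one early time. If it is at least 1/2, the heat kernel
turns it into a pointwise lower bound on a small ball slightly later
(`exists_heatComparison_lower_bound`), and an explicit expanding barrier carries this bound to the
whole of `Q_{r/3}` (`exists_spread`). If it is at most 1/2, the same argument applies to `-u`, which
solves the problem with the two coefficients exchanged. Since only a mean enters, no interior
Harnack inequality for the heat equation is required.

The barrier has to cross a free boundary about which nothing is known. It is a strict subsolution
for both coefficients, so contact inside either phase is impossible. To exclude contact on `{u = 0}`
it is replaced by a kinked function `(1 + ε) w⁺ - w⁻`, whose normal derivatives jump in the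
direction forbidden to a test function from below unless `∇w = 0`. The gradient is a unit vector
plus `h / r` times a bounded one, so flatness keeps it away from zero. This is
`of_kink_touchesFromBelow` and `ge_of_isCompact`. Flatness is used only for the sign and for the
gradient, hence its threshold is universal.

For (b), the oscillation of `u - x_n` decays geometrically along the radii `3⁻ᵏ / 2` for as long as
the flatness condition persists, that is down to a scale comparable with `δ`
(`exists_oscillation_decay`). -/

noncomputable section

namespace FreeTransmission

variable {n : ℕ}

/-! ### Calculus of globally smooth functions on space-time -/

section Calculus

variable {f v : SpaceTime n → ℝ}

theorem contDiff_spaceSlice (hf : ContDiff ℝ 2 f) (t : ℝ) :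
    ContDiff ℝ 2 fun y : EuclideanSpace ℝ (Fin n) => f (y, t) :=
  hf.comp (contDiff_id.prodMk contDiff_const)

theorem contDiff_timeSlice (hf : ContDiff ℝ 2 f) (x : EuclideanSpace ℝ (Fin n)) :
    ContDiff ℝ 2 fun s : ℝ => f (x, s) :=
  hf.comp (contDiff_const.prodMk contDiff_id)

theorem continuous_spaceGrad (hf : ContDiff ℝ 2 f) : Continuous (spaceGrad f) := by
  have h : spaceGrad f = fun p => (InnerProductSpace.toDual ℝ _).symm
      ((fderiv ℝ f p).comp (ContinuousLinearMap.inl ℝ (EuclideanSpace ℝ (Fin n)) ℝ)) := by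
    funext p
    have h1 : HasFDerivAt (fun y : EuclideanSpace ℝ (Fin n) => f (y, p.2))
        ((fderiv ℝ f p).comp (ContinuousLinearMap.inl ℝ (EuclideanSpace ℝ (Fin n)) ℝ)) p.1 := by
      have h2 : HasFDerivAt f (fderiv ℝ f (p.1, p.2)) (p.1, p.2) :=
        (hf.differentiable (by norm_num) _).hasFDerivAt
      exact h2.comp p.1 (hasFDerivAt_prodMk_left p.1 p.2)
    simp only [spaceGrad, gradient, h1.fderiv]
  rw [h]
  have := hf.continuous_fderiv (by norm_num)
  fun_prop

theorem continuous_spaceHess (hf : ContDiff ℝ 2 f) : Continuous (spaceHess f) := by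
  have h : spaceHess f = fun p => (iteratedFDeriv ℝ 2 f p).compContinuousLinearMap
      fun _ => ContinuousLinearMap.inl ℝ (EuclideanSpace ℝ (Fin n)) ℝ := by
    funext p
    have h1 : (fun y : EuclideanSpace ℝ (Fin n) => f (y, p.2)) =
        (fun q => f (q + (0, p.2))) ∘ ContinuousLinearMap.inl ℝ (EuclideanSpace ℝ (Fin n)) ℝ := by
      funext y; simp
    have h2 : ContDiff ℝ 2 fun q : SpaceTime n => f (q + (0, p.2)) :=
      hf.comp (contDiff_id.add contDiff_const)
    rw [spaceHess, h1, ContinuousLinearMap.iteratedFDeriv_comp_right _ h2 _ le_rfl,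
      iteratedFDeriv_comp_add_right]
    simp
  rw [h]
  exact (ContinuousMultilinearMap.compContinuousLinearMapL
    fun _ : Fin 2 => ContinuousLinearMap.inl ℝ (EuclideanSpace ℝ (Fin n)) ℝ).continuous.comp
      (hf.continuous_iteratedFDeriv le_rfl)

theorem continuous_deriv_time (hf : ContDiff ℝ 2 f) :
    Continuous fun p : SpaceTime n => deriv (fun s => f (p.1, s)) p.2 := by
  have h : (fun p : SpaceTime n => deriv (fun s => f (p.1, s)) p.2) =
      fun p => fderiv ℝ f p (0, 1) := by
    funext p
    have h2 : HasFDerivAt f (fderiv ℝ f (p.1, p.2)) (p.1, p.2) :=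
      (hf.differentiable (by norm_num) _).hasFDerivAt
    have h3 := h2.comp_hasDerivAt p.2 ((hasDerivAt_const p.2 p.1).prodMk (hasDerivAt_id p.2))
    exact h3.deriv
  rw [h]
  have := hf.continuous_fderiv (by norm_num)
  fun_prop

theorem timeDeriv_eq_deriv (hf : ContDiff ℝ 2 f) {S : Set (SpaceTime n)} {p : SpaceTime n}
    (h : UniqueDiffWithinAt ℝ (timeSlice S p.1) p.2) :
    timeDeriv S f p = deriv (fun s => f (p.1, s)) p.2 :=
  ((contDiff_timeSlice hf p.1).differentiable (by norm_num) _).derivWithin h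

theorem eventuallyEq_spaceSlice {p : SpaceTime n} (h : v =ᶠ[𝓝 p] f) :
    (fun y => v (y, p.2)) =ᶠ[𝓝 p.1] fun y => f (y, p.2) :=
  (Continuous.prodMk_left p.2).continuousAt.eventually h

theorem eventuallyEq_timeSlice {p : SpaceTime n} (h : v =ᶠ[𝓝 p] f) :
    (fun s => v (p.1, s)) =ᶠ[𝓝 p.2] fun s => f (p.1, s) :=
  (Continuous.prodMk_right p.1).continuousAt.eventually h

theorem spaceGrad_congr {p : SpaceTime n} (h : v =ᶠ[𝓝 p] f) : spaceGrad v p = spaceGrad f p := by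
  simp only [spaceGrad, gradient, (eventuallyEq_spaceSlice h).fderiv_eq]

theorem spaceHess_congr {p : SpaceTime n} (h : v =ᶠ[𝓝 p] f) : spaceHess v p = spaceHess f p :=
  (eventuallyEq_spaceSlice h).iteratedFDeriv ℝ 2 |>.eq_of_nhds

theorem timeDeriv_congr {p : SpaceTime n} (S : Set (SpaceTime n)) (h : v =ᶠ[𝓝 p] f) :
    timeDeriv S v p = timeDeriv S f p :=
  ((eventuallyEq_timeSlice h).filter_mono nhdsWithin_le_nhds).derivWithin_eq
    (eventuallyEq_timeSlice h).eq_of_nhds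

/-- If `v` agrees near `S` with a globally smooth function, it is `C²` up to the closure of `S`. -/
theorem parabolicC2OnClosure_of_eventuallyEq (hf : ContDiff ℝ 2 f) {S : Set (SpaceTime n)}
    (hS : ∀ p ∈ S, UniqueDiffWithinAt ℝ (timeSlice S p.1) p.2) (h : ∀ p ∈ S, v =ᶠ[𝓝 p] f) :
    ParabolicC2OnClosure v S := by
  have h0 : EqOn f v S := fun p hp => (h p hp).eq_of_nhds.symm
  have h1 : EqOn (spaceGrad f) (spaceGrad v) S := fun p hp => (spaceGrad_congr (h p hp)).symm
  have h2 : EqOn (spaceHess f) (spaceHess v) S := fun p hp => (spaceHess_congr (h p hp)).symm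
  have h3 : EqOn (fun p : SpaceTime n => deriv (fun s => f (p.1, s)) p.2) (timeDeriv S v) S :=
    fun p hp => by rw [timeDeriv_congr S (h p hp), timeDeriv_eq_deriv hf (hS p hp)]
  have c0 := hf.continuous
  have c1 := continuous_spaceGrad hf
  have c2 := continuous_spaceHess hf
  have c3 := continuous_deriv_time hf
  refine ⟨⟨fun p hp => ?_, fun p hp => ?_, c0.continuousOn.congr h0.symm,
    c1.continuousOn.congr h1.symm, c2.continuousOn.congr h2.symm, c3.continuousOn.congr h3.symm⟩,
    ⟨_, c0.continuousOn, h0⟩, ⟨_, c1.continuousOn, h1⟩, ⟨_, c2.continuousOn, h2⟩,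
    ⟨_, c3.continuousOn, h3⟩⟩
  · exact (contDiff_spaceSlice hf p.2).contDiffAt.congr_of_eventuallyEq
      (eventuallyEq_spaceSlice (h p hp))
  · exact (((contDiff_timeSlice hf p.1).differentiable (by norm_num) p.2).congr_of_eventuallyEq
      (eventuallyEq_timeSlice (h p hp))).differentiableWithinAt

theorem parabolicC2On_of_contDiff (hf : ContDiff ℝ 2 f) {S : Set (SpaceTime n)}
    (hS : ∀ p ∈ S, UniqueDiffWithinAt ℝ (timeSlice S p.1) p.2) : ParabolicC2On f S :=
  (parabolicC2OnClosure_of_eventuallyEq hf hS fun _ _ => EventuallyEq.rfl).c2On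

end Calculus

/-! ### Relatively open subsets of cylinders -/

theorem cyl_mem_spaceSlice {x₀ : EuclideanSpace ℝ (Fin n)} {t₀ r : ℝ} {p : SpaceTime n}
    (hp : p ∈ cyl x₀ t₀ r) : ∀ᶠ y in 𝓝 p.1, (y, p.2) ∈ cyl x₀ t₀ r :=
  Filter.mem_of_superset (Metric.isOpen_ball.mem_nhds hp.1) fun _ hy => ⟨hy, hp.2⟩

theorem cyl_mem_timeSlice {x₀ : EuclideanSpace ℝ (Fin n)} {t₀ r : ℝ} {p : SpaceTime n}
    (hp : p ∈ cyl x₀ t₀ r) : ∀ᶠ s in 𝓝[≤] p.2, (p.1, s) ∈ cyl x₀ t₀ r := by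
  filter_upwards [nhdsWithin_le_nhds (lt_mem_nhds hp.2.1), self_mem_nhdsWithin] with s hs hs'
  exact ⟨hp.1, hs, le_trans hs' hp.2.2⟩

/-- A relatively open subset of a cylinder contains a short backward time segment below each of its
points. This makes `timeDeriv` of a smooth function its ordinary time derivative, also at the final
time. -/
theorem uniqueDiffWithinAt_timeSlice {x₀ : EuclideanSpace ℝ (Fin n)} {t₀ r : ℝ}
    {S : Set (SpaceTime n)} {p : SpaceTime n} (hp : p ∈ cyl x₀ t₀ r)
    (hS : ∀ᶠ q in 𝓝[cyl x₀ t₀ r] p, q ∈ S) : UniqueDiffWithinAt ℝ (timeSlice S p.1) p.2 := by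
  have h1 : Tendsto (fun s : ℝ => (p.1, s)) (𝓝[≤] p.2) (𝓝[cyl x₀ t₀ r] p) :=
    tendsto_nhdsWithin_iff.2 ⟨((Continuous.prodMk_right p.1).continuousAt (x := p.2)).mono_left
      nhdsWithin_le_nhds, cyl_mem_timeSlice hp⟩
  have h2 : timeSlice S p.1 ∈ 𝓝[≤] p.2 := h1.eventually hS
  exact (uniqueDiffWithinAt_Iic p.2).mono_nhds (nhdsWithin_le_iff.2 h2)

theorem eventually_mem_posPhase {Q : Set (SpaceTime n)} {u : SpaceTime n → ℝ}
    (hu : ContinuousOn u Q) {p : SpaceTime n} (hp : p ∈ posPhase Q u) :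
    ∀ᶠ q in 𝓝[Q] p, q ∈ posPhase Q u := by
  filter_upwards [(hu p hp.1).eventually (lt_mem_nhds hp.2), self_mem_nhdsWithin] with q h1 h2
  exact ⟨h2, h1⟩

theorem eventually_mem_negPhase {Q : Set (SpaceTime n)} {u : SpaceTime n → ℝ}
    (hu : ContinuousOn u Q) {p : SpaceTime n} (hp : p ∈ negPhase Q u) :
    ∀ᶠ q in 𝓝[Q] p, q ∈ negPhase Q u := by
  filter_upwards [(hu p hp.1).eventually (gt_mem_nhds hp.2), self_mem_nhdsWithin] with q h1 h2
  exact ⟨h2, h1⟩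

/-! ### Comparison with smooth strict subsolutions -/

/-- `(1 + ε) w⁺ - w⁻`: a function with a kink along its zero set. -/
def kink (ε : ℝ) (w : SpaceTime n → ℝ) : SpaceTime n → ℝ :=
  fun q => (1 + ε) * max (w q) 0 - max (-w q) 0

section Kink

variable {ε : ℝ} {w : SpaceTime n → ℝ} {q : SpaceTime n}

theorem kink_of_nonneg (h : 0 ≤ w q) : kink ε w q = (1 + ε) * w q := by
  simp [kink, h]

theorem kink_of_nonpos (h : w q ≤ 0) : kink ε w q = w q := by
  simp [kink, h]

theorem kink_pos_iff (hε : 0 < ε) : 0 < kink ε w q ↔ 0 < w q := by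
  rcases le_total (w q) 0 with h | h
  · rw [kink_of_nonpos h]
  · rw [kink_of_nonneg h]; exact mul_pos_iff_of_pos_left (by positivity)

theorem kink_neg_iff (hε : 0 < ε) : kink ε w q < 0 ↔ w q < 0 := by
  rcases le_total (w q) 0 with h | h
  · rw [kink_of_nonpos h]
  · rw [kink_of_nonneg h]
    exact ⟨fun h1 => absurd h1 (not_lt.2 (by positivity)), fun h1 => absurd h1 (not_lt.2 h)⟩

/-- For `ε > 0` the kink is the maximum of its two smooth branches `w` and `(1 + ε) w`. Hence a
branch that is active at a contact point is itself a test function from below there. -/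
theorem mul_le_kink (hε : 0 < ε) : (1 + ε) * w q ≤ kink ε w q := by
  rcases le_total (w q) 0 with h | h
  · rw [kink_of_nonpos h]; nlinarith
  · rw [kink_of_nonneg h]

theorem le_kink (hε : 0 < ε) : w q ≤ kink ε w q := by
  rcases le_total (w q) 0 with h | h
  · rw [kink_of_nonpos h]
  · rw [kink_of_nonneg h]; nlinarith

theorem continuous_kink (hw : Continuous w) : Continuous (kink ε w) := by
  unfold kink; fun_prop

end Kink

theorem spaceLaplacian_const_mul {w : SpaceTime n → ℝ} (hw : ContDiff ℝ 2 w) (c : ℝ)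
    (p : SpaceTime n) : spaceLaplacian (fun q => c * w q) p = c * spaceLaplacian w p :=
  InnerProductSpace.laplacian_smul c (contDiff_spaceSlice hw p.2).contDiffAt

theorem deriv_time_const_mul {w : SpaceTime n → ℝ} (c : ℝ) (p : SpaceTime n) :
    deriv (fun s => c * w (p.1, s)) p.2 = c * deriv (fun s => w (p.1, s)) p.2 :=
  deriv_const_mul_field c

theorem hasGradientAt_spaceGrad {w : SpaceTime n → ℝ} (hw : ContDiff ℝ 2 w) (p : SpaceTime n) :
    HasGradientAt (fun y => w (y, p.2)) (spaceGrad w p) p.1 :=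
  ((contDiff_spaceSlice hw p.2).differentiable (by norm_num) p.1).hasGradientAt

theorem spaceGrad_const_mul {w : SpaceTime n → ℝ} (hw : ContDiff ℝ 2 w) (c : ℝ)
    (p : SpaceTime n) : spaceGrad (fun q => c * w q) p = c • spaceGrad w p := by
  have h := (hasGradientAt_spaceGrad hw p).hasFDerivAt.const_mul c
  have h2 : HasGradientAt (fun y => c * w (y, p.2)) (c • spaceGrad w p) p.1 := by
    rw [hasGradientAt_iff_hasFDerivAt]
    simpa using h
  exact h2.gradient

/-- Where the spatial gradient does not vanish, a zero of `w` is a limit of points, at the same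
time, where `w` is positive. -/
theorem mem_closure_posPhase {w : SpaceTime n → ℝ} (hw : ContDiff ℝ 2 w)
    {x₀ : EuclideanSpace ℝ (Fin n)} {t₀ r : ℝ} {p : SpaceTime n} (hp : p ∈ cyl x₀ t₀ r)
    (h0 : w p = 0) (hg : spaceGrad w p ≠ 0) : p ∈ closure (posPhase (cyl x₀ t₀ r) w) := by
  set g := spaceGrad w p with hgdef
  have hline : HasDerivAt (fun s : ℝ => p.1 + s • g) g 0 := by
    simpa using ((hasDerivAt_id (0 : ℝ)).smul_const g).const_add p.1
  have hd : HasDerivAt (fun s : ℝ => w (p.1 + s • g, p.2)) (inner ℝ g g) 0 := by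
    have h1 := (hasGradientAt_spaceGrad hw p).hasFDerivAt
    have h2 : HasFDerivAt (fun y => w (y, p.2)) ((InnerProductSpace.toDual ℝ _) g)
        (p.1 + (0 : ℝ) • g) := by simpa using h1
    have h3 := h2.comp_hasDerivAt 0 hline
    rwa [InnerProductSpace.toDual_apply_apply] at h3
  have hpos : 0 < inner ℝ g g := real_inner_self_pos.2 hg
  have hslope := (hasDerivAt_iff_tendsto_slope.1 hd).eventually (lt_mem_nhds hpos)
  have hslope' : ∀ᶠ s in 𝓝[>] (0 : ℝ), 0 < w (p.1 + s • g, p.2) := by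
    filter_upwards [nhdsWithin_mono 0 (fun s (hs : 0 < s) => ne_of_gt hs) hslope,
      self_mem_nhdsWithin] with s hs hs0
    have hs0' : (0 : ℝ) < s := hs0
    rw [slope_def_field] at hs
    have := (div_pos_iff_of_pos_right (by simpa using hs0')).1 hs
    simpa [h0] using this
  have hcont : Tendsto (fun s : ℝ => p.1 + s • g) (𝓝[>] 0) (𝓝 p.1) := by
    have := hline.continuousAt.tendsto.mono_left (nhdsWithin_le_nhds (s := Ioi 0))
    simpa using this
  have htend : Tendsto (fun s : ℝ => ((p.1 + s • g, p.2) : SpaceTime n)) (𝓝[>] 0) (𝓝 p) :=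
    hcont.prodMk_nhds tendsto_const_nhds
  refine mem_closure_of_tendsto htend ?_
  filter_upwards [hslope', hcont.eventually (cyl_mem_spaceSlice hp)] with s h1 h2
  exact ⟨h2, h1⟩

theorem posPhase_posFun (Q : Set (SpaceTime n)) (v : SpaceTime n → ℝ) :
    posPhase Q (posFun v) = posPhase Q v := by
  ext; simp [posPhase, posFun]

theorem posPhase_negFun (Q : Set (SpaceTime n)) (v : SpaceTime n → ℝ) :
    posPhase Q (negFun v) = negPhase Q v := by
  ext; simp [posPhase, negPhase, negFun]

theorem hasInwardNormalDeriv_of_eventuallyEq {Q : Set (SpaceTime n)} {v f : SpaceTime n → ℝ}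
    {p : SpaceTime n} (hf : ContDiff ℝ 2 f) (hp : p ∈ closure (posPhase Q v))
    (h : ∀ q ∈ posPhase Q v, v =ᶠ[𝓝 q] f) :
    HasInwardNormalDeriv Q v p ‖spaceGrad f p‖ := by
  refine ⟨hp, spaceGrad f p, ?_, rfl⟩
  refine ((continuous_spaceGrad hf).continuousAt.mono_left nhdsWithin_le_nhds).congr' ?_
  filter_upwards [self_mem_nhdsWithin] with q hq
  exact (spaceGrad_congr (h q hq)).symm

/-- A kinked function `(1 + ε) w⁺ - w⁻` touching a supersolution from below. -/
theorem IsViscositySupersolution.of_kink_touchesFromBelow {aPos aNeg : ℝ}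
    {x₀ : EuclideanSpace ℝ (Fin n)} {t₀ r : ℝ} {u : SpaceTime n → ℝ}
    (hu : IsViscositySupersolution aPos aNeg (cyl x₀ t₀ r) u) {w : SpaceTime n → ℝ}
    (hw : ContDiff ℝ 2 w) {ε : ℝ} (hε : 0 < ε) {p : SpaceTime n} (hp : p ∈ cyl x₀ t₀ r)
    (ht : TouchesFromBelow (cyl x₀ t₀ r) (kink ε w) u p) :
    (0 < u p → 0 ≤ aPos * deriv (fun s => w (p.1, s)) p.2 - spaceLaplacian w p) ∧
      (u p < 0 → 0 ≤ aNeg * deriv (fun s => w (p.1, s)) p.2 - spaceLaplacian w p) ∧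
      (u p = 0 → spaceGrad w p = 0) := by
  set Q := cyl x₀ t₀ r with hQ
  obtain ⟨heq, ρ, hρ, hρQ, hle⟩ := ht
  have hε1 : 0 < 1 + ε := by positivity
  have hw1 : ContDiff ℝ 2 fun q => (1 + ε) * w q := contDiff_const.mul hw
  refine ⟨fun h => ?_, fun h => ?_, fun h => ?_⟩
  · have hwp : 0 < w p := by rwa [heq, kink_pos_iff hε] at h
    have hS : ∀ q ∈ posPhase Q u, UniqueDiffWithinAt ℝ (timeSlice (posPhase Q u) q.1) q.2 :=
      fun q hq => uniqueDiffWithinAt_timeSlice hq.1 (eventually_mem_posPhase hu.continuousOn hq)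
    have h1 := hu.pos (fun q => (1 + ε) * w q) p ⟨hp, h⟩ (parabolicC2On_of_contDiff hw1 hS)
      ⟨by rw [heq, kink_of_nonneg hwp.le], ρ, hρ, hρQ, fun q hq => (mul_le_kink hε).trans (hle q hq)⟩
    rw [timeDeriv_eq_deriv hw1 (hS p ⟨hp, h⟩), deriv_time_const_mul,
      spaceLaplacian_const_mul hw] at h1
    have h2 : 0 ≤ (1 + ε) * (aPos * deriv (fun s => w (p.1, s)) p.2 - spaceLaplacian w p) := by
      linarith
    exact nonneg_of_mul_nonneg_right h2 hε1
  · have hwp : w p < 0 := by rwa [heq, kink_neg_iff hε] at h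
    have hS : ∀ q ∈ negPhase Q u, UniqueDiffWithinAt ℝ (timeSlice (negPhase Q u) q.1) q.2 :=
      fun q hq => uniqueDiffWithinAt_timeSlice hq.1 (eventually_mem_negPhase hu.continuousOn hq)
    have h1 := hu.neg w p ⟨hp, h⟩ (parabolicC2On_of_contDiff hw hS)
      ⟨by rw [heq, kink_of_nonpos hwp.le], ρ, hρ, hρQ, fun q hq => (le_kink hε).trans (hle q hq)⟩
    rwa [timeDeriv_eq_deriv hw (hS p ⟨hp, h⟩)] at h1
  -- If `∇w ≠ 0`, both phases of the kink accumulate at `p` and its one-sided normal derivatives are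
  -- `(1 + ε)|∇w|` and `|∇w|`. The transmission condition from below would give `-ε |∇w| ≥ 0`.
  · by_contra hg
    have hwp : w p = 0 := by
      rw [heq] at h
      refine le_antisymm ?_ ?_
      · by_contra! h'; exact absurd h ((kink_pos_iff hε).2 h').ne'
      · by_contra! h'; exact absurd h ((kink_neg_iff hε).2 h').ne
    have hcont := continuous_kink (ε := ε) hw.continuous
    have hposeq : posPhase Q (kink ε w) = posPhase Q w := by
      ext q; simp [posPhase, kink_pos_iff hε]
    have hnegeq : negPhase Q (kink ε w) = negPhase Q w := by
      ext q; simp [negPhase, kink_neg_iff hε]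
    have hwc : ContinuousOn w Q := hw.continuous.continuousOn
    have e1 : ∀ q ∈ posPhase Q w, ∀ᶠ z in 𝓝 q, 0 < w z :=
      fun q hq => hw.continuous.continuousAt.eventually (lt_mem_nhds hq.2)
    have e2 : ∀ q ∈ negPhase Q w, ∀ᶠ z in 𝓝 q, w z < 0 :=
      fun q hq => hw.continuous.continuousAt.eventually (gt_mem_nhds hq.2)
    have hneg1 : ContDiff ℝ 2 fun q => -1 * w q := contDiff_const.mul hw
    have hcl : p ∈ closure (negPhase Q w) := by
      have : negPhase Q w = posPhase Q fun q => -1 * w q := by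
        ext q; simp [negPhase, posPhase]
      rw [this]
      refine mem_closure_posPhase hneg1 hp (by simp [hwp]) ?_
      rw [spaceGrad_const_mul hw]
      simpa using hg
    have h1 := hu.transmission (kink ε w) p ‖spaceGrad (fun q => (1 + ε) * w q) p‖
      ‖spaceGrad (fun q => -1 * w q) p‖ ⟨hp, h⟩ ⟨hp, heq.symm.trans h⟩ hcont.continuousOn
      (by
        rw [hposeq]
        exact parabolicC2OnClosure_of_eventuallyEq hw1 (fun q hq =>
          uniqueDiffWithinAt_timeSlice hq.1 (eventually_mem_posPhase hwc hq))
          fun q hq => (e1 q hq).mono fun z hz => kink_of_nonneg hz.le)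
      (by
        rw [hnegeq]
        exact parabolicC2OnClosure_of_eventuallyEq hw (fun q hq =>
          uniqueDiffWithinAt_timeSlice hq.1 (eventually_mem_negPhase hwc hq))
          fun q hq => (e2 q hq).mono fun z hz => kink_of_nonpos hz.le)
      ⟨heq, ρ, hρ, hρQ, hle⟩
      (by
        refine hasInwardNormalDeriv_of_eventuallyEq hw1 ?_ ?_ <;> rw [posPhase_posFun, hposeq]
        · exact mem_closure_posPhase hw hp hwp hg
        · refine fun q hq => (e1 q hq).mono fun z hz => ?_
          simp only [posFun]
          rw [kink_of_nonneg hz.le, max_eq_left (by positivity)])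
      (by
        refine hasInwardNormalDeriv_of_eventuallyEq hneg1 ?_ ?_ <;> rw [posPhase_negFun, hnegeq]
        · exact hcl
        · refine fun q hq => (e2 q hq).mono fun z hz => ?_
          simp only [negFun]
          rw [kink_of_nonpos hz.le, max_eq_left (by linarith)]
          ring)
    have hn : 0 < ‖spaceGrad w p‖ := norm_pos_iff.2 hg
    rw [spaceGrad_const_mul hw, spaceGrad_const_mul hw, norm_smul, norm_smul] at h1
    simp only [Real.norm_eq_abs, abs_of_pos hε1, abs_neg, abs_one, one_mul] at h1
    have := h1 (by positivity) hn
    nlinarith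

/-- Comparison principle: a smooth function `f` that is below a supersolution at the points of a
compact set `K` which are not interior (in the parabolic sense), and is a strict subsolution with
nonvanishing gradient at the others, is below the supersolution in `K`. -/
theorem IsViscositySupersolution.ge_of_isCompact {aPos aNeg : ℝ}
    {x₀ : EuclideanSpace ℝ (Fin n)} {t₀ r : ℝ} {u : SpaceTime n → ℝ}
    (hu : IsViscositySupersolution aPos aNeg (cyl x₀ t₀ r) u) {K : Set (SpaceTime n)}
    (hK : IsCompact K) (hKQ : K ⊆ cyl x₀ t₀ r) {f : SpaceTime n → ℝ} (hf : ContDiff ℝ 2 f)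
    (h : ∀ p ∈ K, f p ≤ u p ∨ ((∃ ρ > 0, cyl p.1 p.2 ρ ⊆ K) ∧
      (0 < u p → aPos * deriv (fun s => f (p.1, s)) p.2 - spaceLaplacian f p < 0) ∧
      (u p < 0 → aNeg * deriv (fun s => f (p.1, s)) p.2 - spaceLaplacian f p < 0) ∧
      (u p = 0 → spaceGrad f p ≠ 0))) :
    ∀ p ∈ K, f p ≤ u p := by
  by_contra! hcon
  obtain ⟨q, hqK, hq⟩ := hcon
  have huK : ContinuousOn u K := hu.continuousOn.mono hKQ
  obtain ⟨M, hM⟩ : ∃ M, ∀ p ∈ K, u p ≤ M := by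
    obtain ⟨M, hM⟩ := hK.bddAbove_image huK
    exact ⟨M, fun p hp => hM ⟨p, hp, rfl⟩⟩
  set m := f q - u q with hm
  have hm0 : 0 < m := by linarith
  -- the inverse of the kink `s ↦ (1 + ε) s⁺ - s⁻` is `s ↦ s - (ε / (1 + ε)) s⁺`
  obtain ⟨ε, hε, hεM⟩ : ∃ ε : ℝ, 0 < ε ∧ ε * max M 0 < m :=
    ⟨m / (2 * (max M 0 + 1)), by positivity, by
      have : 0 ≤ max M 0 := le_max_right _ _
      rw [div_mul_eq_mul_div, div_lt_iff₀ (by positivity)]; nlinarith⟩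
  have hε1 : 0 < 1 + ε := by positivity
  let U : SpaceTime n → ℝ := fun p => u p - ε / (1 + ε) * max (u p) 0
  have hUc : ContinuousOn U K := huK.sub (continuousOn_const.mul (ContinuousOn.sup huK continuousOn_const))
  have hεε : ε / (1 + ε) ≤ ε := div_le_self hε.le (by linarith)
  have hε0 : 0 ≤ ε / (1 + ε) := by positivity
  have hUle : ∀ p, U p ≤ u p := fun p => by
    have : 0 ≤ ε / (1 + ε) * max (u p) 0 := by positivity
    simp only [U]; linarith
  -- This is what the choice of `ε` is for: the maximum of `f - U` is at least `m`, so it cannot be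
  -- attained where `f ≤ u`.
  have hleU : ∀ p ∈ K, u p - U p < m := fun p hp => by
    have h1 : ε / (1 + ε) * max (u p) 0 ≤ ε * max M 0 :=
      mul_le_mul hεε (max_le_max_right 0 (hM p hp)) (le_max_right _ _) hε.le
    simp only [U]; linarith
  obtain ⟨p, hpK, hpmax⟩ := hK.exists_isMaxOn ⟨q, hqK⟩ (hf.continuous.continuousOn.sub hUc)
  set s := f p - U p with hs
  have hmax : ∀ z ∈ K, f z - U z ≤ s := fun z hz => hpmax hz
  have hsm : m ≤ s := (by linarith [hUle q] : m ≤ f q - U q).trans (hmax q hqK)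
  rcases h p hpK with hb | ⟨⟨ρ, hρ, hρK⟩, hpos, hneg, hzero⟩
  · linarith [hleU p hpK]
  -- Lowering `f` by a constant changes neither the operator nor the gradient, and the phase is read
  -- off from `u`, not from `f`. So the hypotheses on `f` at `p` pass to `w`.
  set w : SpaceTime n → ℝ := fun z => f z - s with hw
  have hwd : ContDiff ℝ 2 w := hf.sub contDiff_const
  have hkU : ∀ z, w z ≤ U z → kink ε w z ≤ u z := fun z hz => by
    rcases le_total (u z) 0 with h0 | h0
    · have hU : U z = u z := by simp [U, h0]
      rw [kink_of_nonpos (by linarith)]; linarith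
    · have hU : U z = u z / (1 + ε) := by simp only [U, max_eq_left h0]; field_simp; ring
      rcases le_total (w z) 0 with h1 | h1
      · rw [kink_of_nonpos h1]; linarith
      · rw [kink_of_nonneg h1]
        rw [hU, le_div_iff₀ hε1] at hz; linarith
  have hkUp : kink ε w p = u p := by
    have hwp : w p = U p := by simp only [hw, hs]; ring
    rcases le_total (u p) 0 with h0 | h0
    · have hU : U p = u p := by simp [U, h0]
      rw [kink_of_nonpos (by linarith)]; linarith
    · have hU : U p = u p / (1 + ε) := by simp only [U, max_eq_left h0]; field_simp; ring
      rw [kink_of_nonneg (by rw [hwp, hU]; positivity), hwp, hU]; field_simp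
  have hder : deriv (fun s => w (p.1, s)) p.2 = deriv (fun s => f (p.1, s)) p.2 := by
    simp only [hw, deriv_sub_const]
  have hlap : spaceLaplacian w p = spaceLaplacian f p := by
    have h1 := (contDiff_spaceSlice hf p.2).contDiffAt (x := p.1) |>.laplacian_sub
      (contDiff_const (c := s)).contDiffAt
    have h2 : (fun y => w (y, p.2)) = (fun y => f (y, p.2)) - fun _ => s := rfl
    rw [spaceLaplacian, h2, h1]
    simp [spaceLaplacian]
  have hgrad : spaceGrad w p = spaceGrad f p := by
    simp only [spaceGrad, gradient, hw, fderiv_sub_const]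
  obtain ⟨h1, h2, h3⟩ := hu.of_kink_touchesFromBelow hwd hε (hKQ hpK)
    ⟨hkUp.symm, ρ, hρ, hρK.trans hKQ, fun z hz => hkU z (by
      have := hmax z (hρK hz); simp only [hw]; linarith)⟩
  rw [hder, hlap] at h1 h2
  rw [hgrad] at h3
  rcases lt_trichotomy (u p) 0 with h0 | h0 | h0
  · exact absurd (h2 h0) (not_le.2 (hneg h0))
  · exact hzero h0 (h3 h0)
  · exact absurd (h1 h0) (not_le.2 (hpos h0))

/-! ### Laplacians of affine and radial functions -/

section Laplacian

open Laplacian InnerProductSpace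

variable {E : Type*} [NormedAddCommGroup E] [InnerProductSpace ℝ E] [FiniteDimensional ℝ E]

theorem laplacian_eq_sum_fderiv_fderiv (f : E → ℝ) (x : E) :
    Δ f x = ∑ i, fderiv ℝ (fderiv ℝ f) x (stdOrthonormalBasis ℝ E i)
      (stdOrthonormalBasis ℝ E i) := by
  rw [laplacian_eq_iteratedFDeriv_stdOrthonormalBasis]
  simp [iteratedFDeriv_two_apply]

theorem laplacian_inner_left (e x : E) : Δ (fun y : E => inner ℝ e y) x = 0 := by
  have h : fderiv ℝ (fun y : E => inner ℝ e y) = fun _ => innerSL ℝ e := by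
    funext y; exact (innerSL ℝ e).hasFDerivAt.fderiv
  simp [laplacian_eq_sum_fderiv_fderiv, h]

theorem laplacian_comp_smul_sub {G : E → ℝ} (hG : ContDiff ℝ 2 G) (c : ℝ) (y₀ x : E) :
    Δ (fun y => G (c • (y - y₀))) x = c ^ 2 * Δ G (c • (x - y₀)) := by
  have hd : ∀ z, HasFDerivAt G (fderiv ℝ G z) z := fun z =>
    (hG.differentiable (by norm_num) z).hasFDerivAt
  have hd2 : ∀ z, HasFDerivAt (fderiv ℝ G) (fderiv ℝ (fderiv ℝ G) z) z := fun z =>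
    ((hG.fderiv_right (m := 1) (by norm_num)).differentiable (by norm_num) z).hasFDerivAt
  have hA : ∀ y : E, HasFDerivAt (fun y => c • (y - y₀)) (c • ContinuousLinearMap.id ℝ E) y :=
    fun y => ((hasFDerivAt_id y).sub_const y₀).const_smul c
  have h1 : fderiv ℝ (fun y => G (c • (y - y₀))) = fun y => c • fderiv ℝ G (c • (y - y₀)) := by
    funext y
    refine (((hd _).comp y (hA y)).congr_fderiv ?_).fderiv
    ext v; simp
  have h2 : fderiv ℝ (fun y => c • fderiv ℝ G (c • (y - y₀))) x =
      c • (fderiv ℝ (fderiv ℝ G) (c • (x - y₀))).comp (c • ContinuousLinearMap.id ℝ E) :=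
    (((hd2 _).comp x (hA x)).const_smul c).fderiv
  simp only [laplacian_eq_sum_fderiv_fderiv, h1, h2, Finset.mul_sum]
  refine Finset.sum_congr rfl fun i _ => ?_
  simp; ring

omit [FiniteDimensional ℝ E] in
theorem hasFDerivAt_normSq_sub (c z : E) :
    HasFDerivAt (fun y => ‖y - c‖ ^ 2) (2 • innerSL ℝ (z - c)) z := by
  have := ((hasFDerivAt_id z).sub_const c).norm_sq
  simpa using this

omit [FiniteDimensional ℝ E] in
theorem hasFDerivAt_radial {G G' : ℝ → ℝ} (hG : ∀ s, HasDerivAt G (G' s) s) (c z : E) :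
    HasFDerivAt (fun y => G (‖y - c‖ ^ 2)) ((2 * G' (‖z - c‖ ^ 2)) • innerSL ℝ (z - c)) z := by
  have h := (hG (‖z - c‖ ^ 2)).comp_hasFDerivAt z (hasFDerivAt_normSq_sub c z)
  refine h.congr_fderiv ?_
  ext v; simp; ring

/-- The profile is a function of `|z - c|²` rather than of `|z - c|`, which avoids a singularity at
the centre. It serves for both the barrier and the heat kernel. -/
theorem laplacian_radial {G G' G'' : ℝ → ℝ} (hG : ∀ s, HasDerivAt G (G' s) s)
    (hG' : ∀ s, HasDerivAt G' (G'' s) s) (c z : E) :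
    Δ (fun y => G (‖y - c‖ ^ 2)) z =
      4 * ‖z - c‖ ^ 2 * G'' (‖z - c‖ ^ 2) + 2 * Module.finrank ℝ E * G' (‖z - c‖ ^ 2) := by
  have h1 : fderiv ℝ (fun y => G (‖y - c‖ ^ 2)) =
      fun y => (2 * G' (‖y - c‖ ^ 2)) • innerSL ℝ (y - c) := by
    funext y; exact (hasFDerivAt_radial hG c y).fderiv
  -- `innerSL` is typed as conjugate-linear in its first argument; over `ℝ` it can be repackaged as
  -- a linear map and differentiated as such.
  obtain ⟨L, hL⟩ : ∃ L : E →L[ℝ] E →L[ℝ] ℝ, ∀ v, L v = innerSL ℝ v := ⟨innerSL ℝ, fun _ => rfl⟩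
  have h2 : HasFDerivAt (fun y => innerSL ℝ (y - c)) L z := by
    simp only [← hL]
    exact L.hasFDerivAt.comp z ((hasFDerivAt_id z).sub_const c)
  have h3 := ((hasFDerivAt_radial hG' c z).const_mul 2).smul h2
  have h4 : ∀ v : E, fderiv ℝ (fun y => (2 * G' (‖y - c‖ ^ 2)) • innerSL ℝ (y - c)) z v v =
      4 * G'' (‖z - c‖ ^ 2) * (inner ℝ (z - c) v * inner ℝ v (z - c)) +
        2 * G' (‖z - c‖ ^ 2) * ‖v‖ ^ 2 := fun v => by
    have h5 : fderiv ℝ (fun y => (2 * G' (‖y - c‖ ^ 2)) • innerSL ℝ (y - c)) z = _ := h3.fderiv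
    rw [h5, ← real_inner_self_eq_norm_sq v, real_inner_comm (z - c) v]
    simp only [add_apply, smul_apply, ContinuousLinearMap.smulRight_apply, hL, innerSL_apply_apply,
      smul_eq_mul]
    ring
  rw [laplacian_eq_sum_fderiv_fderiv, h1]
  simp only [h4, Finset.sum_add_distrib, ← Finset.mul_sum, OrthonormalBasis.sum_inner_mul_inner,
    OrthonormalBasis.norm_eq_one, real_inner_self_eq_norm_sq]
  simp
  ring

end Laplacian

/-! ### Parabolic rescaling -/

/-- The parabolic dilation by `r` followed by the translation by `(y₀, t₁)`. -/
def dilate (y₀ : EuclideanSpace ℝ (Fin n)) (t₁ r : ℝ) (q : SpaceTime n) : SpaceTime n :=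
  (y₀ + r • q.1, t₁ + r ^ 2 * q.2)

/-- The inverse of `dilate`. -/
def undilate (y₀ : EuclideanSpace ℝ (Fin n)) (t₁ r : ℝ) (p : SpaceTime n) : SpaceTime n :=
  (r⁻¹ • (p.1 - y₀), (p.2 - t₁) / r ^ 2)

section Dilate

variable {y₀ : EuclideanSpace ℝ (Fin n)} {t₁ r : ℝ}

theorem undilate_dilate (hr : 0 < r) (q : SpaceTime n) :
    undilate y₀ t₁ r (dilate y₀ t₁ r q) = q := by
  ext1
  · simp [undilate, dilate, smul_smul, hr.ne']
  · simp [undilate, dilate, hr.ne']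

theorem dilate_undilate (hr : 0 < r) (p : SpaceTime n) :
    dilate y₀ t₁ r (undilate y₀ t₁ r p) = p := by
  ext1
  · simp [undilate, dilate, smul_smul, hr.ne']
  · simp only [undilate, dilate]; field_simp; ring

theorem continuous_dilate : Continuous (dilate y₀ t₁ r : SpaceTime n → SpaceTime n) := by
  unfold dilate; fun_prop

theorem contDiff_undilate : ContDiff ℝ 2 (undilate y₀ t₁ r : SpaceTime n → SpaceTime n) := by
  unfold undilate; fun_prop

theorem cyl_dilate_subset (hr : 0 < r) {q : SpaceTime n} {ρ : ℝ} :
    cyl (dilate y₀ t₁ r q).1 (dilate y₀ t₁ r q).2 (r * ρ) ⊆ dilate y₀ t₁ r '' cyl q.1 q.2 ρ := by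
  intro p hp
  refine ⟨undilate y₀ t₁ r p, ?_, dilate_undilate hr p⟩
  rw [← dilate_undilate (y₀ := y₀) (t₁ := t₁) hr p] at hp
  generalize undilate y₀ t₁ r p = z at hp
  obtain ⟨h1, h2, h3⟩ := hp
  have hr2 : 0 < r ^ 2 := by positivity
  simp only [dilate, mem_ball_iff_norm] at h1 h2 h3
  refine ⟨?_, ?_, ?_⟩
  · rw [add_sub_add_left_eq_sub, ← smul_sub, norm_smul, Real.norm_of_nonneg hr.le] at h1
    exact mem_ball_iff_norm.2 (lt_of_mul_lt_mul_left h1 hr.le)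
  · exact lt_of_mul_lt_mul_left (a := r ^ 2) (by nlinarith) hr2.le
  · exact le_of_mul_le_mul_left (a := r ^ 2) (by linarith) hr2

end Dilate

/-- The comparison principle for `⟪e, x⟫ + A + h g`, with `g` in rescaled variables. -/
theorem IsViscositySupersolution.ge_rescaled {aPos aNeg : ℝ}
    {x₀ : EuclideanSpace ℝ (Fin n)} {t₀ R : ℝ} {u : SpaceTime n → ℝ}
    (hu : IsViscositySupersolution aPos aNeg (cyl x₀ t₀ R) u)
    {y₀ e : EuclideanSpace ℝ (Fin n)} {t₁ r A h : ℝ} (hr : 0 < r) (hh : 0 < h)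
    {K : Set (SpaceTime n)} (hK : IsCompact K)
    (hKQ : ∀ q ∈ K, dilate y₀ t₁ r q ∈ cyl x₀ t₀ R) {g : SpaceTime n → ℝ} (hg : ContDiff ℝ 2 g)
    (hb : ∀ q ∈ K, inner ℝ e (dilate y₀ t₁ r q).1 + A + h * g q ≤ u (dilate y₀ t₁ r q) ∨
      ((∃ ρ > 0, cyl q.1 q.2 ρ ⊆ K) ∧
      (0 < u (dilate y₀ t₁ r q) →
        aPos * deriv (fun s => g (q.1, s)) q.2 - spaceLaplacian g q < 0) ∧
      (u (dilate y₀ t₁ r q) < 0 →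
        aNeg * deriv (fun s => g (q.1, s)) q.2 - spaceLaplacian g q < 0) ∧
      (u (dilate y₀ t₁ r q) = 0 → h * ‖spaceGrad g q‖ < r * ‖e‖))) :
    ∀ q ∈ K, inner ℝ e (dilate y₀ t₁ r q).1 + A + h * g q ≤ u (dilate y₀ t₁ r q) := by
  have hr2 : 0 < r ^ 2 := by positivity
  set f : SpaceTime n → ℝ := fun p => inner ℝ e p.1 + A + h * g (undilate y₀ t₁ r p) with hf
  have hgu : ContDiff ℝ 2 fun p => g (undilate y₀ t₁ r p) := hg.comp contDiff_undilate
  have hfd : ContDiff ℝ 2 f :=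
    ((contDiff_const.inner ℝ contDiff_fst).add contDiff_const).add (contDiff_const.mul hgu)
  have hfq : ∀ q, f (dilate y₀ t₁ r q) =
      inner ℝ e (dilate y₀ t₁ r q).1 + A + h * g q := fun q => by
    simp only [hf, undilate_dilate hr]
  have hder : ∀ q, deriv (fun s => f ((dilate y₀ t₁ r q).1, s)) (dilate y₀ t₁ r q).2 =
      h / r ^ 2 * deriv (fun s => g (q.1, s)) q.2 := fun q => by
    have h1 : HasDerivAt (fun s => g (q.1, s)) (deriv (fun s => g (q.1, s)) q.2)
        (((dilate y₀ t₁ r q).2 - t₁) / r ^ 2) := by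
      have : ((dilate y₀ t₁ r q).2 - t₁) / r ^ 2 = q.2 :=
        congrArg Prod.snd (undilate_dilate (y₀ := y₀) (t₁ := t₁) hr q)
      rw [this]
      exact ((contDiff_timeSlice hg q.1).differentiable (by norm_num) _).hasDerivAt
    have h2 : HasDerivAt (fun s : ℝ => (s - t₁) / r ^ 2) (1 / r ^ 2) (dilate y₀ t₁ r q).2 :=
      ((hasDerivAt_id _).sub_const t₁).div_const _
    have h3 := ((h1.comp (dilate y₀ t₁ r q).2 h2).const_mul h).const_add (inner ℝ e (dilate y₀ t₁ r q).1 + A)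
    have h4 : (fun s => f ((dilate y₀ t₁ r q).1, s)) = fun s =>
        inner ℝ e (dilate y₀ t₁ r q).1 + A +
          h * ((fun s => g (q.1, s)) ∘ fun s : ℝ => (s - t₁) / r ^ 2) s := by
      funext s
      have : r⁻¹ • ((dilate y₀ t₁ r q).1 - y₀) = q.1 :=
        congrArg Prod.fst (undilate_dilate (y₀ := y₀) (t₁ := t₁) hr q)
      simp only [hf, undilate, this, Function.comp]
    rw [h4, h3.deriv]
    ring
  have hslice : ∀ q : SpaceTime n, (fun y => f (y, (dilate y₀ t₁ r q).2)) =
      fun y => inner ℝ e y + A + h * g (r⁻¹ • (y - y₀), q.2) := fun q => by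
    have : ((dilate y₀ t₁ r q).2 - t₁) / r ^ 2 = q.2 :=
      congrArg Prod.snd (undilate_dilate (y₀ := y₀) (t₁ := t₁) hr q)
    funext y
    simp only [hf, undilate, this]
  have hq1 : ∀ q : SpaceTime n, r⁻¹ • ((dilate y₀ t₁ r q).1 - y₀) = q.1 := fun q =>
    congrArg Prod.fst (undilate_dilate (y₀ := y₀) (t₁ := t₁) hr q)
  have hlap : ∀ q, spaceLaplacian f (dilate y₀ t₁ r q) = h / r ^ 2 * spaceLaplacian g q :=
    fun q => by
    have hG := contDiff_spaceSlice hg q.2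
    have hG1 : ContDiff ℝ 2 fun y => g (r⁻¹ • (y - y₀), q.2) :=
      hG.comp (f := fun y => r⁻¹ • (y - y₀)) (by fun_prop)
    have hi : ContDiff ℝ 2 fun y : EuclideanSpace ℝ (Fin n) => inner ℝ e y :=
      contDiff_const.inner ℝ contDiff_id
    have e1 : (fun y => inner ℝ e y + A + h * g (r⁻¹ • (y - y₀), q.2)) =
        ((fun y => inner ℝ e y) + fun _ => A) + h • fun y => g (r⁻¹ • (y - y₀), q.2) := rfl
    rw [spaceLaplacian, hslice, e1, ContDiffAt.laplacian_add (f₁ := (fun y => inner ℝ e y) + fun _ => A)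
        (f₂ := h • fun y => g (r⁻¹ • (y - y₀), q.2))
        (hi.add contDiff_const).contDiffAt (hG1.const_smul h).contDiffAt,
      ContDiffAt.laplacian_add hi.contDiffAt contDiffAt_const,
      InnerProductSpace.laplacian_smul _ hG1.contDiffAt, laplacian_inner_left,
      laplacian_comp_smul_sub hG, hq1]
    simp [spaceLaplacian]
    field_simp
  -- Whence the condition `h ‖∇g‖ < r ‖e‖` at zeros of `u`: it prevents the two terms from
  -- cancelling.
  have hgrad : ∀ q, spaceGrad f (dilate y₀ t₁ r q) = e + (h / r) • spaceGrad g q := fun q => by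
    have h1 := (hasGradientAt_spaceGrad hg q).hasFDerivAt
    rw [← hq1 q] at h1
    have h2 : HasFDerivAt (fun y => r⁻¹ • (y - y₀)) (r⁻¹ • ContinuousLinearMap.id ℝ _)
        (dilate y₀ t₁ r q).1 := ((hasFDerivAt_id _).sub_const y₀).const_smul r⁻¹
    have h3 := (((innerSL ℝ e).hasFDerivAt (x := (dilate y₀ t₁ r q).1)).add_const A).add
      ((h1.comp (dilate y₀ t₁ r q).1 h2).const_mul h)
    have h4 : HasGradientAt (fun y => inner ℝ e y + A + h * g (r⁻¹ • (y - y₀), q.2))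
        (e + (h / r) • spaceGrad g q) (dilate y₀ t₁ r q).1 := by
      rw [hasGradientAt_iff_hasFDerivAt]
      refine h3.congr_fderiv ?_
      ext v
      simp
      field_simp
    rw [spaceGrad, hslice, h4.gradient]
  intro q hq
  have key := hu.ge_of_isCompact (hK.image (continuous_dilate (y₀ := y₀) (t₁ := t₁) (r := r)))
    (by rintro _ ⟨z, hz, rfl⟩; exact hKQ z hz) hfd (by
      rintro _ ⟨z, hz, rfl⟩
      rw [hfq, hder, hlap, hgrad]
      refine (hb z hz).imp_right fun ⟨⟨ρ, hρ, hρK⟩, h1, h2, h3⟩ => ⟨⟨r * ρ, by positivity,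
        (cyl_dilate_subset hr).trans (image_mono hρK)⟩, fun h0 => ?_, fun h0 => ?_, fun h0 => ?_⟩
      · have := mul_neg_of_pos_of_neg (div_pos hh hr2) (h1 h0)
        linarith
      · have := mul_neg_of_pos_of_neg (div_pos hh hr2) (h2 h0)
        linarith
      · intro h4
        have h5 : ‖e‖ = h / r * ‖spaceGrad g z‖ := by
          rw [eq_neg_of_add_eq_zero_left h4, norm_neg, norm_smul, Real.norm_of_nonneg (by positivity)]
        have := h3 h0
        rw [h5] at this
        field_simp at this
        exact lt_irrefl _ this)
    (dilate y₀ t₁ r q) ⟨q, hq, rfl⟩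
  rwa [hfq] at key

/-! ### The expanding barrier -/

theorem exists_cyl_subset {q : SpaceTime n} {U : Set (SpaceTime n)} (hU : U ∈ 𝓝 q) :
    ∃ ρ > 0, ∀ p ∈ cyl q.1 q.2 ρ, p ∈ U ∧ p.2 ≤ q.2 := by
  obtain ⟨δ, hδ, hball⟩ := Metric.mem_nhds_iff.1 hU
  have h1 : 0 < min δ 1 := lt_min hδ one_pos
  refine ⟨min δ 1, h1, fun p ⟨hp1, hp2, hp3⟩ => ⟨hball ?_, hp3⟩⟩
  have h2 : min δ 1 ^ 2 ≤ min δ 1 := by nlinarith [min_le_right δ 1]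
  rw [Metric.mem_ball, Prod.dist_eq]
  refine max_lt (lt_of_lt_of_le hp1 (min_le_left _ _)) ?_
  rw [Real.dist_eq, abs_sub_lt_iff]
  constructor <;> linarith [min_le_left δ 1]

theorem spaceGrad_radial {g : SpaceTime n → ℝ} {q : SpaceTime n} {c : EuclideanSpace ℝ (Fin n)}
    {G G' : ℝ → ℝ} (hg : ∀ y, g (y, q.2) = G (‖y - c‖ ^ 2)) (hG : ∀ s, HasDerivAt G (G' s) s) :
    spaceGrad g q = (2 * G' (‖q.1 - c‖ ^ 2)) • (q.1 - c) := by
  have h : HasGradientAt (fun y => g (y, q.2)) ((2 * G' (‖q.1 - c‖ ^ 2)) • (q.1 - c)) q.1 := by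
    rw [hasGradientAt_iff_hasFDerivAt]
    simp only [hg]
    refine (hasFDerivAt_radial hG c q.1).congr_fderiv ?_
    ext v; simp
  exact h.gradient

theorem spaceLaplacian_radial {g : SpaceTime n → ℝ} {q : SpaceTime n}
    {c : EuclideanSpace ℝ (Fin n)} {G G' G'' : ℝ → ℝ} (hg : ∀ y, g (y, q.2) = G (‖y - c‖ ^ 2))
    (hG : ∀ s, HasDerivAt G (G' s) s) (hG' : ∀ s, HasDerivAt G' (G'' s) s) :
    spaceLaplacian g q =
      4 * ‖q.1 - c‖ ^ 2 * G'' (‖q.1 - c‖ ^ 2) + 2 * n * G' (‖q.1 - c‖ ^ 2) := by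
  simp only [spaceLaplacian, hg]
  rw [laplacian_radial hG hG']
  simp

/-- The barrier is `m exp(-lτ) f²` with `f = ρ² + κτ - |z|²`, on the expanding set `{f ≥ 0}`. Where
`f` is small, squaring makes the Laplacian positive; elsewhere the exponential decay with large `l`
dominates. The estimate is uniform over an interval of coefficients, so it does not see the free
boundary and also serves `-u`, where the coefficients are exchanged. -/
theorem IsViscositySupersolution.exists_spread (n : ℕ) {aMin aMax ρ : ℝ} (ha : 0 < aMin)
    (hρ : 0 < ρ) (hρ' : ρ ≤ 1 / 20) :
    ∃ c > 0, ∀ aPos ∈ Icc aMin aMax, ∀ aNeg ∈ Icc aMin aMax,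
      ∀ {x₀ : EuclideanSpace ℝ (Fin n)} {t₀ R : ℝ} {u : SpaceTime n → ℝ},
      IsViscositySupersolution aPos aNeg (cyl x₀ t₀ R) u →
      ∀ {y₀ e : EuclideanSpace ℝ (Fin n)} {t₁ r A h m : ℝ}, 0 < r → 0 < h → h ≤ r / 100 →
      ‖e‖ = 1 → 0 < m → m ≤ 1 →
      (∀ q : SpaceTime n, ‖q.1‖ ≤ 4 / 5 → q.2 ∈ Icc 0 (1 / 2) →
        dilate y₀ t₁ r q ∈ cyl x₀ t₀ R ∧
          inner ℝ e (dilate y₀ t₁ r q).1 + A ≤ u (dilate y₀ t₁ r q)) →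
      (∀ z : EuclideanSpace ℝ (Fin n), ‖z‖ ≤ ρ →
        inner ℝ e (dilate y₀ t₁ r (z, 0)).1 + A + h * m ≤ u (dilate y₀ t₁ r (z, 0))) →
      ∀ q : SpaceTime n, ‖q.1‖ ≤ 13 / 30 → q.2 ∈ Icc (7 / 18) (1 / 2) →
        inner ℝ e (dilate y₀ t₁ r q).1 + A + h * (c * m) ≤ u (dilate y₀ t₁ r q) := by
  -- Chosen so that the radius of `{f ≥ 0}` grows from `ρ` at time 0 to `4/5` at time `1/2`.
  set κ : ℝ := 2 * (16 / 25 - ρ ^ 2) with hκ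
  have hρ2 : ρ ^ 2 ≤ 1 / 400 := by nlinarith
  have hρ2' : 0 < ρ ^ 2 := by positivity
  have hκ0 : 0 < κ := by rw [hκ]; linarith
  set B : ℝ := 2 * aMax * κ + 4 * n + 8 with hB
  set l : ℝ := B ^ 2 / (16 * ρ ^ 2 * aMin) with hl
  have hl0 : 0 ≤ l := by positivity
  refine ⟨Real.exp (-(l / 2)) * (3 / 10) ^ 2, by positivity, ?_⟩
  intro aPos hPos aNeg hNeg x₀ t₀ R u hu y₀ e t₁ r A h m hr hh hhr he hm hm1 hlow hinit
  let S : ℝ → ℝ := fun τ => ρ ^ 2 + κ * τ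
  let f : SpaceTime n → ℝ := fun q => S q.2 - ‖q.1‖ ^ 2
  let g : SpaceTime n → ℝ := fun q => m * Real.exp (-(l * q.2)) * f q ^ 2
  have hfc : ContDiff ℝ 2 f := by
    have : ContDiff ℝ 2 fun q : SpaceTime n => ‖q.1‖ ^ 2 := contDiff_fst.norm_sq ℝ
    simp only [f, S]; fun_prop
  have hgc : ContDiff ℝ 2 g := by
    have : ContDiff ℝ 2 fun q : SpaceTime n => Real.exp (-(l * q.2)) := by fun_prop
    exact (contDiff_const.mul this).mul (hfc.pow 2)
  let K : Set (SpaceTime n) := {q | q.2 ∈ Icc (0 : ℝ) (1 / 2) ∧ 0 ≤ f q}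
  have hKS : ∀ q ∈ K, ‖q.1‖ ≤ 4 / 5 ∧ f q ≤ 16 / 25 := fun q ⟨⟨h1, h2⟩, h3⟩ => by
    have h4 : S q.2 ≤ 16 / 25 := by simp only [S, hκ]; nlinarith
    simp only [f] at h3 ⊢
    exact ⟨abs_le_of_sq_le_sq' (by linarith) (by norm_num) |>.2, by nlinarith [sq_nonneg ‖q.1‖]⟩
  have hK : IsCompact K := by
    refine ((isCompact_closedBall (0 : EuclideanSpace ℝ (Fin n)) (4 / 5)).prod
      (isCompact_Icc (a := (0 : ℝ)) (b := 1 / 2))).of_isClosed_subset ?_ ?_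
    · exact (isClosed_Icc.preimage continuous_snd).inter
        (isClosed_le continuous_const hfc.continuous)
    · exact fun q hq => ⟨by simpa using (hKS q hq).1, hq.1⟩
  have hexp : ∀ τ : ℝ, 0 ≤ τ → Real.exp (-(l * τ)) ≤ 1 := fun τ hτ =>
    Real.exp_le_one_iff.2 (by nlinarith [mul_nonneg hl0 hτ])
  have hder : ∀ q : SpaceTime n, deriv (fun s => g (q.1, s)) q.2 =
      m * Real.exp (-(l * q.2)) * (2 * κ * f q - l * f q ^ 2) := fun q => by
    have h1 : HasDerivAt (fun s : ℝ => m * Real.exp (-(l * s))) (m * (Real.exp (-(l * q.2)) * -l))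
        q.2 := by
      have := ((hasDerivAt_id q.2).const_mul l).neg.exp.const_mul m
      simpa using this
    have h2 : HasDerivAt (fun s : ℝ => ρ ^ 2 + κ * s - ‖q.1‖ ^ 2) κ q.2 := by
      simpa using (((hasDerivAt_id q.2).const_mul κ).const_add (ρ ^ 2)).sub_const (‖q.1‖ ^ 2)
    have h3 : HasDerivAt (fun s => g (q.1, s)) _ q.2 := h1.mul (h2.pow 2)
    rw [h3.deriv]
    simp only [f, S]
    push_cast
    ring
  have hG : ∀ q : SpaceTime n, ∀ s, HasDerivAt
      (fun s => m * Real.exp (-(l * q.2)) * (S q.2 - s) ^ 2)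
      (m * Real.exp (-(l * q.2)) * (-2 * (S q.2 - s))) s := fun q s => by
    have h1 := (((hasDerivAt_id s).const_sub (S q.2)).pow 2).const_mul
      (m * Real.exp (-(l * q.2)))
    refine h1.congr_deriv ?_
    simp
  have hG' : ∀ q : SpaceTime n, ∀ s, HasDerivAt
      (fun s => m * Real.exp (-(l * q.2)) * (-2 * (S q.2 - s)))
      (m * Real.exp (-(l * q.2)) * 2) s := fun q s => by
    have h1 := (((hasDerivAt_id s).const_sub (S q.2)).const_mul (-2)).const_mul
      (m * Real.exp (-(l * q.2)))
    refine h1.congr_deriv ?_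
    ring
  have hgG : ∀ q : SpaceTime n, ∀ y, g (y, q.2) =
      (fun s => m * Real.exp (-(l * q.2)) * (S q.2 - s) ^ 2) (‖y - 0‖ ^ 2) := fun q y => by
    simp only [g, f, sub_zero]
  have hlap : ∀ q : SpaceTime n, spaceLaplacian g q =
      m * Real.exp (-(l * q.2)) * (8 * ‖q.1‖ ^ 2 - 4 * n * f q) := fun q => by
    rw [spaceLaplacian_radial (hgG q) (hG q) (hG' q)]
    simp only [f, sub_zero]
    ring
  have hgrad : ∀ q : SpaceTime n, ‖spaceGrad g q‖ =
      |m * Real.exp (-(l * q.2)) * (4 * f q)| * ‖q.1‖ := fun q => by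
    rw [spaceGrad_radial (hgG q) (hG q), norm_smul, Real.norm_eq_abs, ← abs_neg]
    simp only [f, sub_zero]
    ring_nf
  have hstrict : ∀ a ∈ Icc aMin aMax, ∀ q ∈ K,
      a * deriv (fun s => g (q.1, s)) q.2 - spaceLaplacian g q < 0 := by
    intro a haI q hq
    have hf0 : 0 ≤ f q := hq.2
    have hz : ‖q.1‖ ^ 2 = S q.2 - f q := by simp only [f]; ring
    have hS : ρ ^ 2 ≤ S q.2 := by
      have := mul_nonneg hκ0.le hq.1.1
      simp only [S]; linarith
    have h1 : B ^ 2 * f q ^ 2 / (16 * ρ ^ 2) ≤ a * l * f q ^ 2 := by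
      have e1 : B ^ 2 * f q ^ 2 / (16 * ρ ^ 2) = aMin * l * f q ^ 2 := by
        rw [hl]; field_simp
      rw [e1]
      gcongr
      exact haI.1
    -- Completing the square; `l` is defined so that the quadratic term is `aMin * l * f²`. The only
    -- unfavourable term, linear in `f`, is thus absorbed by the other two.
    have h2 : B * f q < 8 * ρ ^ 2 + B ^ 2 * f q ^ 2 / (16 * ρ ^ 2) := by
      have e2 : 8 * ρ ^ 2 + B ^ 2 * f q ^ 2 / (16 * ρ ^ 2) - B * f q =
          (B * f q / (4 * ρ) - 2 * ρ) ^ 2 + 4 * ρ ^ 2 := by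
        field_simp; ring
      have := sq_nonneg (B * f q / (4 * ρ) - 2 * ρ)
      linarith
    have h3 : (2 * a * κ + 4 * n + 8) * f q ≤ B * f q := by
      rw [hB]
      have := haI.2
      gcongr
    have h4 : a * deriv (fun s => g (q.1, s)) q.2 - spaceLaplacian g q =
        m * Real.exp (-(l * q.2)) *
          ((2 * a * κ + 4 * n + 8) * f q - 8 * S q.2 - a * l * f q ^ 2) := by
      rw [hder, hlap, hz]; ring
    rw [h4]
    exact mul_neg_of_pos_of_neg (by positivity) (by linarith)
  have key := hu.ge_rescaled (e := e) (A := A) hr hh hK (fun q hq => (hlow q (hKS q hq).1 hq.1).1)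
    hgc (fun q hq => by
      have hf0 : 0 ≤ f q := hq.2
      rcases hf0.eq_or_lt with hf1 | hf1
      · left
        have : g q = 0 := by simp only [g, ← hf1]; ring
        rw [this]
        linarith [(hlow q (hKS q hq).1 hq.1).2]
      rcases hq.1.1.eq_or_lt with hτ | hτ
      · left
        have hq0 : q = (q.1, 0) := by ext1 <;> simp [← hτ]
        have hz : ‖q.1‖ ≤ ρ := by
          refine abs_le_of_sq_le_sq' ?_ hρ.le |>.2
          simp only [f, S, ← hτ] at hf0
          linarith
        have hg1 : g q ≤ m := by
          have e1 := hexp q.2 hq.1.1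
          have e2 : f q ^ 2 ≤ 1 := by nlinarith [(hKS q hq).2]
          simp only [g]
          calc m * Real.exp (-(l * q.2)) * f q ^ 2 ≤ m * 1 * 1 := by gcongr
            _ = m := by ring
        have e3 := hinit q.1 hz
        rw [← hq0] at e3
        have := mul_le_mul_of_nonneg_left hg1 hh.le
        linarith
      · right
        refine ⟨?_, fun _ => hstrict aPos hPos q hq, fun _ => hstrict aNeg hNeg q hq, fun _ => ?_⟩
        · obtain ⟨ρ₁, hρ₁, hsub⟩ := exists_cyl_subset (q := q)
            (((isOpen_lt continuous_const continuous_snd).inter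
              (isOpen_lt continuous_const hfc.continuous)).mem_nhds ⟨hτ, hf1⟩)
          exact ⟨ρ₁, hρ₁, fun p hp => ⟨⟨(hsub p hp).1.1.le, (hsub p hp).2.trans hq.1.2⟩,
            (hsub p hp).1.2.le⟩⟩
        · rw [hgrad, he, abs_of_nonneg (by positivity)]
          obtain ⟨e1, e2⟩ := hKS q hq
          have e3 := hexp q.2 hq.1.1
          -- The rescaled gradient is at most `4 · (16/25) · (4/5) < 100`, whatever the dimension
          -- and the coefficients.
          calc h * (m * Real.exp (-(l * q.2)) * (4 * f q) * ‖q.1‖)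
              ≤ r / 100 * (1 * 1 * (4 * (16 / 25)) * (4 / 5)) := by gcongr
            _ < r * 1 := by linarith)
  intro q hq1 hq2
  have hSq : 3 / 10 ≤ f q := by
    have h1 : 49 / 100 ≤ S q.2 := by
      have := mul_le_mul_of_nonneg_left hq2.1 hκ0.le
      simp only [S]
      rw [hκ] at this ⊢
      linarith
    have h2 : ‖q.1‖ ^ 2 ≤ (13 / 30) ^ 2 := by gcongr
    simp only [f]
    linarith
  have hqK : q ∈ K := ⟨⟨by linarith [hq2.1], hq2.2⟩, by linarith⟩
  have hgq : Real.exp (-(l / 2)) * (3 / 10) ^ 2 * m ≤ g q := by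
    have e1 : Real.exp (-(l / 2)) ≤ Real.exp (-(l * q.2)) :=
      Real.exp_le_exp.2 (by nlinarith [mul_le_mul_of_nonneg_left hq2.2 hl0])
    calc Real.exp (-(l / 2)) * (3 / 10) ^ 2 * m ≤ Real.exp (-(l * q.2)) * f q ^ 2 * m := by gcongr
      _ = g q := by simp only [g]; ring
  have := mul_le_mul_of_nonneg_left hgq hh.le
  linarith [key q hqK]

/-! ### The heat kernel -/

/-- The Gauss kernel `(4 π s)^{-n/2} exp (-|x|² / (4 s))`. -/
def heatKernel (x : EuclideanSpace ℝ (Fin n)) (s : ℝ) : ℝ :=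
  Real.exp (-(n / 2 * Real.log (4 * Real.pi * s)) - ‖x‖ ^ 2 / (4 * s))

theorem heatKernel_pos (x : EuclideanSpace ℝ (Fin n)) (s : ℝ) : 0 < heatKernel x s :=
  Real.exp_pos _

theorem heatKernel_eq_mul (x : EuclideanSpace ℝ (Fin n)) (s : ℝ) :
    heatKernel x s = Real.exp (-(n / 2 * Real.log (4 * Real.pi * s))) *
      Real.exp (-(1 / (4 * s)) * ‖x‖ ^ 2) := by
  rw [heatKernel, ← Real.exp_add]; ring_nf

theorem integral_heatKernel {s : ℝ} (hs : 0 < s) :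
    ∫ x : EuclideanSpace ℝ (Fin n), heatKernel x s = 1 := by
  have hb : 0 < 1 / (4 * s) := by positivity
  simp only [heatKernel_eq_mul, MeasureTheory.integral_const_mul,
    GaussianFourier.integral_rexp_neg_mul_sq_norm hb]
  rw [show Real.pi / (1 / (4 * s)) = 4 * Real.pi * s by field_simp,
    Real.rpow_def_of_pos (by positivity), ← Real.exp_add, finrank_euclideanSpace_fin]
  rw [Real.exp_eq_one_iff]; ring

theorem integrable_heatKernel {s : ℝ} (hs : 0 < s) :
    MeasureTheory.Integrable fun x : EuclideanSpace ℝ (Fin n) => heatKernel x s := by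
  -- A non-integrable function has integral 0 by convention, whereas this integral is 1.
  by_contra h
  have := integral_heatKernel (n := n) hs
  rw [MeasureTheory.integral_undef h] at this
  exact zero_ne_one this

theorem integrable_heatKernel_sub {s : ℝ} (hs : 0 < s) (z : EuclideanSpace ℝ (Fin n)) :
    MeasureTheory.Integrable fun y : EuclideanSpace ℝ (Fin n) => heatKernel (z - y) s :=
  (integrable_heatKernel hs).comp_sub_left z

theorem setIntegral_heatKernel_le {s : ℝ} (hs : 0 < s) (z : EuclideanSpace ℝ (Fin n))
    (B : Set (EuclideanSpace ℝ (Fin n))) : ∫ y in B, heatKernel (z - y) s ≤ 1 := by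
  calc ∫ y in B, heatKernel (z - y) s ≤ ∫ y, heatKernel (z - y) s :=
        MeasureTheory.setIntegral_le_integral (integrable_heatKernel_sub hs z)
          (Eventually.of_forall fun y => (heatKernel_pos _ _).le)
    _ = 1 := by
      rw [MeasureTheory.integral_sub_left_eq_self (fun y => heatKernel y s) _ z,
        integral_heatKernel hs]

/-- Half of the Gaussian exponent absorbs `|x|²`, since `t e⁻ᵗ ≤ 1`; what remains is the kernel at
the doubled time, up to the factor `2^{n/2}`. It replaces the computation of the second moment. -/
theorem normSq_mul_heatKernel_le {s : ℝ} (hs : 0 < s) (x : EuclideanSpace ℝ (Fin n)) :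
    ‖x‖ ^ 2 * heatKernel x s ≤ 8 * s * Real.exp (n / 2 * Real.log 2) * heatKernel x (2 * s) := by
  have h1 : heatKernel x s = Real.exp (n / 2 * Real.log 2) * heatKernel x (2 * s) *
      Real.exp (-(‖x‖ ^ 2 / (8 * s))) := by
    have : Real.log (4 * Real.pi * (2 * s)) = Real.log 2 + Real.log (4 * Real.pi * s) := by
      rw [← Real.log_mul (by norm_num) (by positivity)]; ring_nf
    simp only [heatKernel]
    rw [this, ← Real.exp_add, ← Real.exp_add]
    congr 1
    field_simp
    ring
  have h2 : ‖x‖ ^ 2 * Real.exp (-(‖x‖ ^ 2 / (8 * s))) ≤ 8 * s := by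
    have h3 : ‖x‖ ^ 2 / (8 * s) ≤ Real.exp (‖x‖ ^ 2 / (8 * s)) := by
      linarith [Real.add_one_le_exp (‖x‖ ^ 2 / (8 * s))]
    rw [div_le_iff₀ (by positivity)] at h3
    rw [Real.exp_neg, ← div_eq_mul_inv, div_le_iff₀ (Real.exp_pos _)]
    linarith
  have h4 : 0 ≤ Real.exp (n / 2 * Real.log 2) * heatKernel x (2 * s) :=
    mul_nonneg (Real.exp_pos _).le (heatKernel_pos _ _).le
  rw [h1]
  nlinarith [mul_le_mul_of_nonneg_left h2 h4]

/-- Far from the origin the heat kernel is at most its value at a later time. -/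
theorem heatKernel_le {δ s S : ℝ} (hs : 0 < s) (hsS : s ≤ S) (hS : 2 * n * S ≤ δ ^ 2)
    (hδ : 0 ≤ δ) {x : EuclideanSpace ℝ (Fin n)} (hx : δ ≤ ‖x‖) :
    heatKernel x s ≤
      Real.exp (-(n / 2 * Real.log (4 * Real.pi * S)) - δ ^ 2 / (4 * S)) := by
  have hS0 : 0 < S := hs.trans_le hsS
  have h1 : Real.log (4 * Real.pi * S) = Real.log (S / s) + Real.log (4 * Real.pi * s) := by
    rw [← Real.log_mul (by positivity) (by positivity)]
    congr 1; field_simp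
  -- At distance `δ` the kernel increases in time as long as `2 n s ≤ δ²`; this inequality gives the
  -- integrated form of that monotonicity.
  have h2 : Real.log (S / s) ≤ S / s - 1 := Real.log_le_sub_one_of_pos (by positivity)
  have h3 : δ ^ 2 / (4 * s) ≤ ‖x‖ ^ 2 / (4 * s) := by gcongr
  have h4 : (n / 2 : ℝ) * (S / s - 1) ≤ δ ^ 2 / (4 * s) - δ ^ 2 / (4 * S) := by
    have e1 : (n / 2 : ℝ) * (S / s - 1) = (2 * n * S) * ((S - s) / (4 * s * S)) := by
      field_simp; ring
    have e2 : δ ^ 2 / (4 * s) - δ ^ 2 / (4 * S) = δ ^ 2 * ((S - s) / (4 * s * S)) := by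
      field_simp
    rw [e1, e2]
    have : 0 ≤ (S - s) / (4 * s * S) := div_nonneg (by linarith) (by positivity)
    gcongr
  have h5 : (n / 2 : ℝ) * Real.log (S / s) ≤ n / 2 * (S / s - 1) := by gcongr
  refine Real.exp_le_exp.2 ?_
  rw [h1]
  linarith

theorem le_heatKernel {δ s S : ℝ} (hs : 0 < s) (hsS : s ≤ S) (hS : S ≤ 2 * s)
    {x : EuclideanSpace ℝ (Fin n)} (hx : ‖x‖ ≤ δ) :
    Real.exp (-(n / 2 * Real.log (4 * Real.pi * S)) - δ ^ 2 / (2 * S)) ≤ heatKernel x s := by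
  have hS0 : 0 < S := hs.trans_le hsS
  have h1 : Real.log (4 * Real.pi * s) ≤ Real.log (4 * Real.pi * S) :=
    Real.log_le_log (by positivity) (by gcongr)
  have h2 : ‖x‖ ^ 2 / (4 * s) ≤ δ ^ 2 / (2 * S) := by
    have : 2 * S ≤ 4 * s := by linarith
    gcongr
  have h3 : (n / 2 : ℝ) * Real.log (4 * Real.pi * s) ≤ n / 2 * Real.log (4 * Real.pi * S) := by
    gcongr
  exact Real.exp_le_exp.2 (by linarith)

/-- Convolution with the heat kernel at a small time does not increase a nonnegative continuous
function by much. -/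
theorem exists_setIntegral_mul_heatKernel_le {φ : EuclideanSpace ℝ (Fin n) → ℝ} {d : ℝ}
    (hφ : ContinuousOn φ (Metric.closedBall 0 d)) (h0 : ∀ y ∈ Metric.closedBall 0 d, 0 ≤ φ y)
    {η κ₀ : ℝ} (hη : 0 < η) (hκ₀ : 0 < κ₀) :
    ∃ κ ∈ Ioc 0 κ₀, ∀ z ∈ Metric.closedBall 0 d,
      ∫ y in Metric.closedBall 0 d, φ y * heatKernel (z - y) κ ≤ φ z + η := by
  have hcomp : IsCompact (Metric.closedBall (0 : EuclideanSpace ℝ (Fin n)) d) :=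
    isCompact_closedBall _ _
  obtain ⟨b, hb⟩ : ∃ b, ∀ y ∈ Metric.closedBall 0 d, φ y ≤ b := by
    obtain ⟨b, hb⟩ := hcomp.bddAbove_image hφ
    exact ⟨b, fun y hy => hb ⟨y, hy, rfl⟩⟩
  obtain ⟨δ, hδ, hunif⟩ := Metric.uniformContinuousOn_iff.1
    (hcomp.uniformContinuousOn_of_continuous hφ) (η / 2) (by positivity)
  set E : ℝ := Real.exp (n / 2 * Real.log 2) with hE
  have hE0 : 0 < E := Real.exp_pos _
  set C : ℝ := max b 0 / δ ^ 2 with hC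
  have hC0 : 0 ≤ C := by positivity
  set D : ℝ := 8 * C * E with hD
  have hD0 : 0 ≤ D := by positivity
  refine ⟨min κ₀ (η / (2 * (D + 1))), ⟨by positivity, min_le_left _ _⟩, fun z hz => ?_⟩
  set κ := min κ₀ (η / (2 * (D + 1))) with hκ
  have hκ0 : 0 < κ := by positivity
  have hDκ : D * κ ≤ η / 2 := by
    have h1 : κ ≤ η / (2 * (D + 1)) := min_le_right _ _
    rw [le_div_iff₀ (by positivity)] at h1
    nlinarith
  -- Uniform continuity handles nearby points, and the quadratic term exceeds the upper bound of `φ`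
  -- at distance `δ` or more. Its integral against the kernel is at most `D * κ`.
  have hquad : ∀ y ∈ Metric.closedBall 0 d, φ y ≤ φ z + η / 2 + C * ‖z - y‖ ^ 2 := fun y hy => by
    by_cases hyz : dist y z < δ
    · have := hunif y hy z hz hyz
      rw [Real.dist_eq] at this
      have h2 : 0 ≤ C * ‖z - y‖ ^ 2 := by positivity
      linarith [le_abs_self (φ y - φ z)]
    · have h1 : δ ≤ ‖z - y‖ := by rw [← dist_eq_norm, dist_comm]; exact not_lt.1 hyz
      have h2 : max b 0 ≤ C * ‖z - y‖ ^ 2 := by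
        rw [hC, div_mul_eq_mul_div, le_div_iff₀ (by positivity)]
        gcongr
      linarith [hb y hy, le_max_left b 0, h0 z hz]
  have hz0 : 0 ≤ φ z + η / 2 := by linarith [h0 z hz]
  have hI1 := integrable_heatKernel_sub hκ0 z
  have hI2 := integrable_heatKernel_sub (s := 2 * κ) (by positivity) z
  have hpt : ∀ y ∈ Metric.closedBall (0 : EuclideanSpace ℝ (Fin n)) d,
      φ y * heatKernel (z - y) κ ≤
        (φ z + η / 2) * heatKernel (z - y) κ + D * κ * heatKernel (z - y) (2 * κ) :=
    fun y hy => by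
      have h1 := mul_le_mul_of_nonneg_right (hquad y hy) (heatKernel_pos (z - y) κ).le
      have h2 := mul_le_mul_of_nonneg_left (normSq_mul_heatKernel_le hκ0 (z - y)) hC0
      rw [hD]
      linarith
  calc ∫ y in Metric.closedBall 0 d, φ y * heatKernel (z - y) κ
      ≤ ∫ y in Metric.closedBall 0 d, ((φ z + η / 2) * heatKernel (z - y) κ +
          D * κ * heatKernel (z - y) (2 * κ)) := by
        refine MeasureTheory.setIntegral_mono_on ?_
          ((hI1.const_mul _).add (hI2.const_mul _)).integrableOn measurableSet_closedBall hpt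
        refine ContinuousOn.integrableOn_compact hcomp (hφ.mul ?_)
        unfold heatKernel
        fun_prop
    _ = (φ z + η / 2) * (∫ y in Metric.closedBall 0 d, heatKernel (z - y) κ) +
          D * κ * ∫ y in Metric.closedBall 0 d, heatKernel (z - y) (2 * κ) := by
        rw [MeasureTheory.integral_add (hI1.const_mul _).integrableOn
          (hI2.const_mul _).integrableOn, MeasureTheory.integral_const_mul,
          MeasureTheory.integral_const_mul]
    _ ≤ (φ z + η / 2) * 1 + D * κ * 1 := by
        gcongr
        · exact setIntegral_heatKernel_le hκ0 z _
        · exact setIntegral_heatKernel_le (by positivity) z _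
    _ ≤ φ z + η := by linarith

/-! ### Heat subsolutions -/

/-- Smooth functions on space-time that satisfy `a g_t - Δ g ≤ 0` at positive times. -/
structure IsHeatSubsolution (a : ℝ) (g : SpaceTime n → ℝ) : Prop where
  contDiff : ContDiff ℝ 2 g
  le : ∀ q, 0 < q.2 → a * deriv (fun s => g (q.1, s)) q.2 - spaceLaplacian g q ≤ 0

theorem spaceLaplacian_add {f g : SpaceTime n → ℝ} (hf : ContDiff ℝ 2 f) (hg : ContDiff ℝ 2 g)
    (q : SpaceTime n) :
    spaceLaplacian (fun p => f p + g p) q = spaceLaplacian f q + spaceLaplacian g q :=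
  ContDiffAt.laplacian_add (contDiff_spaceSlice hf q.2).contDiffAt
    (contDiff_spaceSlice hg q.2).contDiffAt

theorem deriv_time_add {f g : SpaceTime n → ℝ} (hf : ContDiff ℝ 2 f) (hg : ContDiff ℝ 2 g)
    (q : SpaceTime n) : deriv (fun s => f (q.1, s) + g (q.1, s)) q.2 =
      deriv (fun s => f (q.1, s)) q.2 + deriv (fun s => g (q.1, s)) q.2 :=
  deriv_fun_add ((contDiff_timeSlice hf q.1).differentiable (by norm_num) _)
    ((contDiff_timeSlice hg q.1).differentiable (by norm_num) _)

theorem spaceLaplacian_time (φ : ℝ → ℝ) (q : SpaceTime n) :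
    spaceLaplacian (fun p => φ p.2) q = 0 := by
  simp [spaceLaplacian]

namespace IsHeatSubsolution

variable {a : ℝ} {f g : SpaceTime n → ℝ}

theorem add (hf : IsHeatSubsolution a f) (hg : IsHeatSubsolution a g) :
    IsHeatSubsolution a fun q => f q + g q := by
  refine ⟨hf.contDiff.add hg.contDiff, fun q hq => ?_⟩
  rw [spaceLaplacian_add hf.contDiff hg.contDiff, deriv_time_add hf.contDiff hg.contDiff]
  linarith [hf.le q hq, hg.le q hq]

theorem const_mul (hf : IsHeatSubsolution a f) {c : ℝ} (hc : 0 ≤ c) :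
    IsHeatSubsolution a fun q => c * f q := by
  refine ⟨contDiff_const.mul hf.contDiff, fun q hq => ?_⟩
  rw [spaceLaplacian_const_mul hf.contDiff, deriv_time_const_mul]
  nlinarith [mul_nonpos_of_nonneg_of_nonpos hc (hf.le q hq)]

theorem const (c : ℝ) : IsHeatSubsolution a fun _ : SpaceTime n => c := by
  refine ⟨contDiff_const, fun q _ => ?_⟩
  rw [spaceLaplacian_time fun _ => c]
  simp

end IsHeatSubsolution

/-- A smooth positive function on `ℝ` equal to `t / a + κ` for `t ≥ 0`. -/
theorem exists_smooth_time {a κ : ℝ} (ha : 0 < a) (hκ : 0 < κ) :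
    ∃ σ : ℝ → ℝ, ContDiff ℝ 2 σ ∧ (∀ t, 0 < σ t) ∧ ∀ t, 0 ≤ t → σ t = t / a + κ := by
  refine ⟨fun t => t / a * Real.smoothTransition (1 + 2 * t / (a * κ)) + κ, ?_, fun t => ?_,
    fun t ht => ?_⟩
  · have : ContDiff ℝ 2 fun t : ℝ => Real.smoothTransition (1 + 2 * t / (a * κ)) :=
      (Real.smoothTransition.contDiff (n := 2)).comp (by fun_prop)
    fun_prop
  · have h0 := Real.smoothTransition.nonneg (1 + 2 * t / (a * κ))
    have h1 := Real.smoothTransition.le_one (1 + 2 * t / (a * κ))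
    rcases le_total 0 t with ht | ht
    · positivity
    · dsimp only
      by_cases h2 : 1 + 2 * t / (a * κ) ≤ 0
      · rw [Real.smoothTransition.zero_of_nonpos h2]; simpa
      · have h3 : -(κ / 2) < t / a := by
          have h4 : -1 < 2 * t / (a * κ) := by linarith [not_le.1 h2]
          rw [lt_div_iff₀ (by positivity)] at h4
          rw [lt_div_iff₀ ha]
          linarith
        nlinarith [div_nonpos_of_nonpos_of_nonneg ht ha.le]
  · have h1 : 1 ≤ 1 + 2 * t / (a * κ) := by
      have : 0 ≤ 2 * t / (a * κ) := by positivity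
      linarith
    simp only [Real.smoothTransition.one_of_one_le h1, mul_one]

/-- The kernel at time `t / a + κ` solves `a g_t = Δg`. The shift `κ` removes the singularity at
time 0, and the extension `σ` to negative times only keeps the function globally smooth. -/
theorem isHeatSubsolution_heatKernel {a κ : ℝ} (ha : 0 < a) {σ : ℝ → ℝ} (hσ : ContDiff ℝ 2 σ)
    (hσ0 : ∀ t, 0 < σ t) (hσt : ∀ t, 0 ≤ t → σ t = t / a + κ) (y : EuclideanSpace ℝ (Fin n)) :
    IsHeatSubsolution a fun q => heatKernel (q.1 - y) (σ q.2) := by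
  have hne : ∀ t, 4 * Real.pi * σ t ≠ 0 := fun t => by have := hσ0 t; positivity
  have hne' : ∀ t, 4 * σ t ≠ 0 := fun t => by have := hσ0 t; positivity
  refine ⟨?_, fun q hq => le_of_eq ?_⟩
  · have h1 : ContDiff ℝ 2 fun q : SpaceTime n => ‖q.1 - y‖ ^ 2 :=
      (contDiff_fst.sub contDiff_const).norm_sq ℝ
    have h2 : ContDiff ℝ 2 fun q : SpaceTime n => σ q.2 := hσ.comp contDiff_snd
    have h3 : ContDiff ℝ 2 fun q : SpaceTime n => Real.log (4 * Real.pi * σ q.2) :=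
      (contDiff_const.mul h2).log fun q => hne q.2
    have h4 : ContDiff ℝ 2 fun q : SpaceTime n => ‖q.1 - y‖ ^ 2 / (4 * σ q.2) :=
      h1.div (contDiff_const.mul h2) fun q => hne' q.2
    exact Real.contDiff_exp.comp (((contDiff_const.mul h3).neg).sub h4)
  · set s := σ q.2 with hs
    have hs0 : 0 < s := hσ0 q.2
    set k := heatKernel (q.1 - y) s with hk
    have hder : HasDerivAt σ (1 / a) q.2 := by
      have h1 : HasDerivAt (fun t : ℝ => t / a + κ) (1 / a) q.2 :=
        ((hasDerivAt_id q.2).div_const a).add_const κ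
      refine h1.congr_of_eventuallyEq ?_
      filter_upwards [lt_mem_nhds hq] with t ht using hσt t ht.le
    have ht : HasDerivAt (fun t => heatKernel (q.1 - y) (σ t))
        (k * (-(n / 2 * (1 / s)) + ‖q.1 - y‖ ^ 2 / (4 * s ^ 2)) * (1 / a)) q.2 := by
      have h1 : HasDerivAt (fun t => heatKernel (q.1 - y) t)
          (k * (-(n / 2 * (1 / s)) + ‖q.1 - y‖ ^ 2 / (4 * s ^ 2))) s := by
        have e1 := (((hasDerivAt_id s).const_mul (4 * Real.pi)).log (hne q.2)).const_mul
          (n / 2 : ℝ)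
        have e2 := (hasDerivAt_const s (‖q.1 - y‖ ^ 2)).div ((hasDerivAt_id s).const_mul 4)
          (hne' q.2)
        have e3 : HasDerivAt (fun t => heatKernel (q.1 - y) t) _ s := (e1.neg.sub e2).exp
        refine e3.congr_deriv ?_
        change k * (-(n / 2 * (4 * Real.pi * 1 / (4 * Real.pi * s))) -
          (0 * (4 * s) - ‖q.1 - y‖ ^ 2 * (4 * 1)) / (4 * s) ^ 2) = _
        field_simp
        ring
      exact h1.comp q.2 hder
    have hG : ∀ S : ℝ, HasDerivAt
        (fun S => Real.exp (-(n / 2 * Real.log (4 * Real.pi * s)) - S / (4 * s)))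
        (-(1 / (4 * s)) * Real.exp (-(n / 2 * Real.log (4 * Real.pi * s)) - S / (4 * s))) S :=
      fun S => by
        have := (((hasDerivAt_id S).div_const (4 * s)).const_sub
          (-(n / 2 * Real.log (4 * Real.pi * s)))).exp
        refine this.congr_deriv ?_
        simp only [id]; ring
    have hG' := fun S => (hG S).const_mul (-(1 / (4 * s)))
    rw [ht.deriv, spaceLaplacian_radial (c := y) (fun z => rfl) hG hG']
    change a * (k * (-(n / 2 * (1 / s)) + ‖q.1 - y‖ ^ 2 / (4 * s ^ 2)) * (1 / a)) -
      (4 * ‖q.1 - y‖ ^ 2 * (-(1 / (4 * s)) * (-(1 / (4 * s)) * k)) +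
        2 * n * (-(1 / (4 * s)) * k)) = 0
    field_simp
    ring

/-! ### A lower bound by the mean at an earlier time -/

/-- `w` lies above a smooth strict subsolution of the heat equation in the cylinder
`{|x| ≤ d} × [0, T]` as soon as it does so on the parabolic boundary. -/
def HeatComparison (a d T : ℝ) (w : SpaceTime n → ℝ) : Prop :=
  ∀ g : SpaceTime n → ℝ, ContDiff ℝ 2 g →
    (∀ q, 0 < q.2 → a * deriv (fun s => g (q.1, s)) q.2 - spaceLaplacian g q < 0) →
    (∀ q ∈ Metric.closedBall 0 d ×ˢ Icc 0 T, ‖q.1‖ = d ∨ q.2 = 0 → g q ≤ w q) →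
    ∀ q ∈ Metric.closedBall 0 d ×ˢ Icc 0 T, g q ≤ w q

/-- The continuous functions on `K` that are restrictions of smooth heat subsolutions. -/
def heatSubsolutionsOn (a : ℝ) (K : Set (SpaceTime n)) : Set C(K, ℝ) :=
  {f | ∃ g : SpaceTime n → ℝ, IsHeatSubsolution a g ∧ ∀ q : K, f q = g q}

theorem convex_heatSubsolutionsOn (a : ℝ) (K : Set (SpaceTime n)) :
    Convex ℝ (heatSubsolutionsOn a K) := by
  rintro f₁ ⟨g₁, h₁, e₁⟩ f₂ ⟨g₂, h₂, e₂⟩ s t hs ht -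
  exact ⟨_, (h₁.const_mul hs).add (h₂.const_mul ht), fun q => by simp [e₁, e₂]⟩

/-- A smooth subsolution `η`-close to `V` becomes strict, and stays below `w` on the parabolic
boundary, after subtracting `η (1 + t)`; the total loss is at most `η (2 + T)`. Uniform limits need
no derivatives of their own. -/
theorem HeatComparison.ge_of_mem_closure {a d T : ℝ} (ha : 0 < a) (hT : 0 ≤ T)
    {w : SpaceTime n → ℝ} (hw : HeatComparison a d T w)
    [CompactSpace (Metric.closedBall (0 : EuclideanSpace ℝ (Fin n)) d ×ˢ Icc 0 T : Set _)]
    {V : C((Metric.closedBall (0 : EuclideanSpace ℝ (Fin n)) d ×ˢ Icc 0 T : Set _), ℝ)}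
    (hV : V ∈ closure (heatSubsolutionsOn a _))
    (hb : ∀ q, ‖q.1.1‖ = d ∨ q.1.2 = 0 → V q ≤ w q) (q) : V q ≤ w q := by
  refine le_of_forall_pos_le_add fun ε hε => ?_
  obtain ⟨f, ⟨g, hg, hfg⟩, hdist⟩ := Metric.mem_closure_iff.1 hV (ε / (2 + T)) (by positivity)
  set η := ε / (2 + T) with hη
  have hη0 : 0 < η := by positivity
  have hηε : η * (2 + T) = ε := by rw [hη]; field_simp
  have hVg : ∀ p, |V p - g p| ≤ η := fun p => by
    have := (ContinuousMap.dist_apply_le_dist (f := V) (g := f) p).trans hdist.le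
    rwa [Real.dist_eq, hfg] at this
  have hlin : ContDiff ℝ 2 fun p : SpaceTime n => -η - η * p.2 := by fun_prop
  have h1 := hw (fun p => g p + (-η - η * p.2)) (hg.contDiff.add hlin)
    (fun p hp => by
      have e1 : deriv (fun s : ℝ => -η - η * s) p.2 = -η := by
        have : HasDerivAt (fun s : ℝ => -η - η * s) (-(η * 1)) p.2 :=
          ((hasDerivAt_id p.2).const_mul η).const_sub (-η)
        rw [this.deriv]; ring
      have e2 := hg.le p hp
      rw [deriv_time_add hg.contDiff hlin, spaceLaplacian_add hg.contDiff hlin,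
        spaceLaplacian_time fun s => -η - η * s, e1]
      nlinarith [mul_pos ha hη0])
    (fun p hp hpb => by
      have e1 := hb ⟨p, hp⟩ hpb
      have e2 := abs_le.1 (hVg ⟨p, hp⟩)
      have e3 := mul_nonneg hη0.le hp.2.1
      simp only at e1 e2 ⊢
      linarith) q.1 q.2
  have e2 := abs_le.1 (hVg q)
  have e3 := mul_le_mul_of_nonneg_left q.2.2.2 hη0.le
  linarith

/-- The tent function of radius `ρ`. -/
def tent (ρ : ℝ) (y : EuclideanSpace ℝ (Fin n)) : ℝ := max 0 (ρ - ‖y‖)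

theorem continuous_tent (ρ : ℝ) : Continuous (tent ρ : EuclideanSpace ℝ (Fin n) → ℝ) := by
  unfold tent; fun_prop

theorem tent_nonneg (ρ : ℝ) (y : EuclideanSpace ℝ (Fin n)) : 0 ≤ tent ρ y := le_max_left _ _

/-- The comparison function is the heat evolution of `tent * w(·, 0)` lowered by `M J`, where `J` is
the weighted integral and `M` bounds the kernel between the support of the tent and the lateral
boundary. Near the centre at time `T` the kernel is at least `M + m`, so `m J` survives. -/
theorem exists_heatComparison_lower_bound (n : ℕ) {a d : ℝ} (ha : 0 < a) (hd : 0 < d)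
    (hd1 : d ≤ 1) :
    ∃ T > 0, T ≤ 1 / 4 ∧ ∃ m > 0, ∀ w : SpaceTime n → ℝ,
      ContinuousOn w (Metric.closedBall 0 d ×ˢ Icc 0 T) →
      (∀ q ∈ Metric.closedBall 0 d ×ˢ Icc 0 T, 0 ≤ w q) → HeatComparison a d T w →
      ∀ z : EuclideanSpace ℝ (Fin n), ‖z‖ ≤ d / 8 →
        m * ∫ y in Metric.closedBall 0 d, tent (d / 8) y * w (y, 0) ≤ w (z, T) := by
  -- Points of the support `|y| ≤ d/8` are at distance at least `7d/8` from the lateral boundary;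
  -- `T` is so small that the kernel at that distance is still increasing up to the time `S`.
  set T : ℝ := min (1 / 4) (a * (7 * d / 8) ^ 2 / (4 * (n + 1))) with hTdef
  have hT : 0 < T := by positivity
  set S : ℝ := 2 * T / a with hS
  have hS0 : 0 < S := by positivity
  have hSd : 2 * n * S ≤ (7 * d / 8) ^ 2 := by
    have h1 : T ≤ a * (7 * d / 8) ^ 2 / (4 * (n + 1)) := min_le_right _ _
    rw [le_div_iff₀ (by positivity)] at h1
    rw [hS, ← mul_div_assoc, div_le_iff₀ ha]
    nlinarith
  set L : ℝ := -(n / 2 * Real.log (4 * Real.pi * S)) with hL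
  set M : ℝ := Real.exp (L - (7 * d / 8) ^ 2 / (4 * S)) with hM
  set m : ℝ := Real.exp (L - (d / 4) ^ 2 / (2 * S)) - M with hm
  have hm0 : 0 < m := by
    rw [hm, hM, sub_pos]
    refine Real.exp_lt_exp.2 (sub_lt_sub_left ?_ L)
    rw [div_lt_div_iff₀ (by positivity) (by positivity)]
    nlinarith [mul_pos hS0 (pow_pos hd 2)]
  refine ⟨T, hT, min_le_left _ _, m, hm0, fun w hwc hw0 hw z hz => ?_⟩
  set B : Set (EuclideanSpace ℝ (Fin n)) := Metric.closedBall 0 d with hBdef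
  have hBc : IsCompact B := isCompact_closedBall _ _
  set K : Set (SpaceTime n) := B ×ˢ Icc 0 T with hKdef
  have hKc : IsCompact K := hBc.prod isCompact_Icc
  have : CompactSpace K := isCompact_iff_compactSpace.1 hKc
  set φ : EuclideanSpace ℝ (Fin n) → ℝ := fun y => tent (d / 8) y * w (y, 0) with hφ
  have hφc : ContinuousOn φ B := (continuous_tent _).continuousOn.mul
    (hwc.comp (Continuous.prodMk_left (0 : ℝ)).continuousOn fun y hy =>
      ⟨hy, left_mem_Icc.2 hT.le⟩)
  have hw0' : ∀ y ∈ B, 0 ≤ w (y, 0) := fun y hy => hw0 _ ⟨hy, left_mem_Icc.2 hT.le⟩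
  have hφ0 : ∀ y ∈ B, 0 ≤ φ y := fun y hy => mul_nonneg (tent_nonneg _ _) (hw0' y hy)
  have hφi : MeasureTheory.IntegrableOn φ B := hφc.integrableOn_compact hBc
  set J : ℝ := ∫ y in B, φ y with hJ
  have hJ0 : 0 ≤ J := MeasureTheory.setIntegral_nonneg measurableSet_closedBall hφ0
  have hMJ : 0 ≤ M * J := mul_nonneg (Real.exp_pos _).le hJ0
  have hvol0 : MeasureTheory.volume B ≠ 0 := by
    exact (Metric.measure_closedBall_pos _ _ hd).ne'
  have hvol1 : MeasureTheory.volume B ≠ ⊤ := hBc.measure_lt_top.ne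
  set c : ℝ := MeasureTheory.volume.real B with hc
  have hc0 : 0 < c := ENNReal.toReal_pos hvol0 hvol1
  refine le_of_forall_pos_le_add fun η hη => ?_
  obtain ⟨κ, ⟨hκ0, hκ1⟩, hκφ⟩ := exists_setIntegral_mul_heatKernel_le hφc hφ0 hη
    (by positivity : 0 < T / a)
  obtain ⟨σ, hσ, hσ0, hσt⟩ := exists_smooth_time ha hκ0
  have hσS : ∀ t ∈ Icc 0 T, σ t ≤ S := fun t ht => by
    rw [hσt t ht.1, hS]
    have : t / a ≤ T / a := by gcongr; exact ht.2
    linarith [show 2 * T / a = T / a + T / a by ring]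
  have hk : ∀ y : EuclideanSpace ℝ (Fin n),
      IsHeatSubsolution a fun q => heatKernel (q.1 - y) (σ q.2) := fun y =>
    isHeatSubsolution_heatKernel ha hσ hσ0 hσt y
  have hkc : Continuous fun p : EuclideanSpace ℝ (Fin n) × K =>
      heatKernel (p.2.1.1 - p.1) (σ p.2.1.2) := by
    have hne : ∀ t, 4 * Real.pi * σ t ≠ 0 := fun t => by have := hσ0 t; positivity
    have hne' : ∀ t, 4 * σ t ≠ 0 := fun t => by have := hσ0 t; positivity
    have hσc := hσ.continuous
    unfold heatKernel
    refine Real.continuous_exp.comp (Continuous.sub ?_ (Continuous.div ?_ ?_ fun p => hne' _))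
    · exact (continuous_const.mul (Continuous.log (by fun_prop) fun p => hne _)).neg
    · fun_prop
    · fun_prop
  let Γ : C(EuclideanSpace ℝ (Fin n), C(K, ℝ)) := ContinuousMap.curry ⟨_, hkc⟩
  -- The convolution is realised as an average of elements of a convex set, hence lies in its
  -- closure; this avoids differentiating under the integral. The factor `c`, the volume of the
  -- ball, undoes the normalisation of the average.
  let F : EuclideanSpace ℝ (Fin n) → C(K, ℝ) := fun y =>
    (c * φ y) • Γ y - ContinuousMap.const K (M * J + η)
  have hFc : ContinuousOn F B :=
    ((continuousOn_const.mul hφc).smul Γ.continuous.continuousOn).sub continuousOn_const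
  have hFi : MeasureTheory.IntegrableOn F B := hFc.integrableOn_compact hBc
  have hFS : ∀ y ∈ B, F y ∈ heatSubsolutionsOn a K := fun y hy =>
    ⟨_, ((hk y).const_mul (mul_nonneg hc0.le (hφ0 y hy))).add
      (IsHeatSubsolution.const (-(M * J + η))), fun q => by simp [F, Γ]; ring⟩
  set V : C(K, ℝ) := ⨍ y in B, F y with hV
  have hVmem : V ∈ closure (heatSubsolutionsOn a K) :=
    (convex_heatSubsolutionsOn a K).set_average_mem_closure hvol0 hvol1
      ((MeasureTheory.ae_restrict_iff' measurableSet_closedBall).2 (Eventually.of_forall hFS)) hFi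
  have hkci : ∀ q : K, MeasureTheory.IntegrableOn
      (fun y => φ y * heatKernel (q.1.1 - y) (σ q.1.2)) B := fun q =>
    (hφc.mul (hkc.comp (Continuous.prodMk_left q)).continuousOn).integrableOn_compact hBc
  have hVq : ∀ q : K, V q =
      (∫ y in B, φ y * heatKernel (q.1.1 - y) (σ q.1.2)) - (M * J + η) := fun q => by
    have e1 : ∀ y, F y q = c * (φ y * heatKernel (q.1.1 - y) (σ q.1.2)) - (M * J + η) :=
      fun y => by simp [F, Γ]; ring
    rw [hV, MeasureTheory.setAverage_eq, ContinuousMap.smul_apply,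
      ContinuousMap.integral_apply hFi]
    simp only [e1]
    rw [MeasureTheory.integral_sub ((hkci q).const_mul c) (MeasureTheory.integrableOn_const hvol1),
      MeasureTheory.integral_const_mul, MeasureTheory.setIntegral_const, ← hc, smul_eq_mul,
      smul_eq_mul]
    field_simp
  have htent : ∀ y : EuclideanSpace ℝ (Fin n), d / 8 < ‖y‖ → φ y = 0 := fun y hy => by
    simp only [hφ, tent]
    rw [max_eq_left (by linarith), zero_mul]
  have hVb : ∀ q : K, ‖q.1.1‖ = d ∨ q.1.2 = 0 → V q ≤ w q := by
    rintro ⟨q, hq⟩ hqb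
    have hwq := hw0 q hq
    rw [hVq]
    rcases hqb with hqd | hq0
    · simp only at hqd
      have h1 : ∫ y in B, φ y * heatKernel (q.1 - y) (σ q.2) ≤ ∫ y in B, φ y * M := by
        refine MeasureTheory.setIntegral_mono_on (hkci ⟨q, hq⟩) (hφi.mul_const M)
          measurableSet_closedBall fun y hy => ?_
        by_cases hyd : d / 8 < ‖y‖
        · simp [htent y hyd]
        · refine mul_le_mul_of_nonneg_left ?_ (hφ0 y hy)
          refine heatKernel_le (hσ0 _) (hσS _ hq.2) hSd (by positivity) ?_
          have := norm_sub_norm_le q.1 y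
          linarith [not_lt.1 hyd]
      rw [MeasureTheory.integral_mul_const] at h1
      simp only
      linarith [mul_comm J M]
    · simp only at hq0
      have h1 := hκφ q.1 hq.1
      have hqe : q = (q.1, 0) := by ext1 <;> simp [← hq0]
      have h2 : φ q.1 ≤ w q := by
        have e1 : tent (d / 8) q.1 ≤ 1 := by
          unfold tent
          exact max_le zero_le_one (by linarith [norm_nonneg q.1])
        have e2 := mul_le_mul_of_nonneg_right e1 (hw0' q.1 hq.1)
        rw [one_mul] at e2
        rw [hqe]
        exact e2
      have h3 : σ q.2 = κ := by rw [hq0, hσt 0 le_rfl]; simp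
      simp only [h3]
      linarith
  have hzB : z ∈ B := mem_closedBall_zero_iff.2 (by linarith)
  have hkey := hw.ge_of_mem_closure ha hT.le hVmem hVb ⟨(z, T), hzB, right_mem_Icc.2 hT.le⟩
  rw [hVq] at hkey
  have hσT : σ T = T / a + κ := hσt T hT.le
  have hlow : (M + m) * J ≤ ∫ y in B, φ y * heatKernel (z - y) (σ T) := by
    have h1 : ∫ y in B, φ y * (M + m) ≤ ∫ y in B, φ y * heatKernel (z - y) (σ T) := by
      refine MeasureTheory.setIntegral_mono_on (hφi.mul_const _)
        (hkci ⟨(z, T), hzB, right_mem_Icc.2 hT.le⟩) measurableSet_closedBall fun y hy => ?_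
      by_cases hyd : d / 8 < ‖y‖
      · simp [htent y hyd]
      · refine mul_le_mul_of_nonneg_left ?_ (hφ0 y hy)
        have e1 : M + m = Real.exp (L - (d / 4) ^ 2 / (2 * S)) := by rw [hm]; ring
        rw [e1]
        refine le_heatKernel (hσ0 _) (hσS T (right_mem_Icc.2 hT.le)) ?_ ?_
        · rw [hσT, hS]
          linarith [show 2 * T / a = 2 * (T / a) by ring]
        · linarith [norm_sub_le z y, not_lt.1 hyd]
    rw [MeasureTheory.integral_mul_const] at h1
    linarith
  simp only at hkey
  linarith

/-! ### The symmetry `u ↦ -u` -/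

section Neg

variable {v : SpaceTime n → ℝ} {Q S : Set (SpaceTime n)}

theorem spaceGrad_neg (v : SpaceTime n → ℝ) : spaceGrad (-v) = -spaceGrad v := by
  funext p
  simp only [spaceGrad, gradient, Pi.neg_apply, fderiv_fun_neg, map_neg]

theorem spaceHess_neg (v : SpaceTime n → ℝ) : spaceHess (-v) = -spaceHess v := by
  funext p
  exact iteratedFDeriv_neg_apply

theorem timeDeriv_neg (S : Set (SpaceTime n)) (v : SpaceTime n → ℝ) :
    timeDeriv S (-v) = -timeDeriv S v := by
  funext p
  simp only [timeDeriv, Pi.neg_apply, derivWithin.fun_neg]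

theorem spaceLaplacian_neg (v : SpaceTime n → ℝ) (p : SpaceTime n) :
    spaceLaplacian (-v) p = -spaceLaplacian v p := by
  have h : (fun y => (-v) (y, p.2)) = -fun y => v (y, p.2) := rfl
  rw [spaceLaplacian, h, InnerProductSpace.laplacian_neg]
  rfl

theorem ParabolicC2On.neg (h : ParabolicC2On v S) : ParabolicC2On (-v) S where
  contDiff_space p hp := (h.contDiff_space p hp).neg
  diff_time p hp := (h.diff_time p hp).neg
  continuousOn := h.continuousOn.neg
  continuousOn_grad := by rw [spaceGrad_neg]; exact h.continuousOn_grad.neg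
  continuousOn_hess := by rw [spaceHess_neg]; exact h.continuousOn_hess.neg
  continuousOn_time := by rw [timeDeriv_neg]; exact h.continuousOn_time.neg

theorem ExtendsToClosure.neg {F : Type*} [TopologicalSpace F] [AddGroup F]
    [IsTopologicalAddGroup F] {f : SpaceTime n → F} (h : ExtendsToClosure f S) :
    ExtendsToClosure (-f) S := by
  obtain ⟨g, hg, he⟩ := h
  exact ⟨-g, hg.neg, fun p hp => congrArg Neg.neg (he hp)⟩

theorem ParabolicC2OnClosure.neg (h : ParabolicC2OnClosure v S) :
    ParabolicC2OnClosure (-v) S where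
  c2On := h.c2On.neg
  extends_self := h.extends_self.neg
  extends_grad := by rw [spaceGrad_neg]; exact h.extends_grad.neg
  extends_hess := by rw [spaceHess_neg]; exact h.extends_hess.neg
  extends_time := by rw [timeDeriv_neg]; exact h.extends_time.neg

theorem posPhase_neg (Q : Set (SpaceTime n)) (v : SpaceTime n → ℝ) :
    posPhase Q (-v) = negPhase Q v := by
  ext; simp [posPhase, negPhase]

theorem negPhase_neg (Q : Set (SpaceTime n)) (v : SpaceTime n → ℝ) :
    negPhase Q (-v) = posPhase Q v := by
  ext; simp [posPhase, negPhase]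

theorem freeBoundary_neg (Q : Set (SpaceTime n)) (v : SpaceTime n → ℝ) :
    freeBoundary Q (-v) = freeBoundary Q v := by
  ext; simp [freeBoundary]

theorem posFun_neg (v : SpaceTime n → ℝ) : posFun (-v) = negFun v := rfl

theorem negFun_neg (v : SpaceTime n → ℝ) : negFun (-v) = posFun v := by
  funext p; simp [posFun, negFun]

theorem TouchesFromBelow.neg {u : SpaceTime n → ℝ} {p : SpaceTime n}
    (h : TouchesFromBelow Q v (-u) p) : TouchesFromAbove Q (-v) u p := by
  obtain ⟨h1, r, hr, hQ, h2⟩ := h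
  exact ⟨by rw [Pi.neg_apply, ← h1, Pi.neg_apply, neg_neg], r, hr, hQ,
    fun q hq => le_neg_of_le_neg (h2 q hq)⟩

/-- Negation exchanges the phases, hence the coefficients, and reverses both touching and the
transmission inequality. -/
theorem IsViscositySubsolution.supersolution_neg {aPos aNeg : ℝ} {u : SpaceTime n → ℝ}
    (hu : IsViscositySubsolution aPos aNeg Q u) :
    IsViscositySupersolution aNeg aPos Q (-u) where
  continuousOn := hu.continuousOn.neg
  pos v p hp hv ht := by
    rw [posPhase_neg] at hp hv ⊢
    have := hu.neg (-v) p hp hv.neg ht.neg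
    rw [timeDeriv_neg, spaceLaplacian_neg, Pi.neg_apply] at this
    linarith
  neg v p hp hv ht := by
    rw [negPhase_neg] at hp hv ⊢
    have := hu.pos (-v) p hp hv.neg ht.neg
    rw [timeDeriv_neg, spaceLaplacian_neg, Pi.neg_apply] at this
    linarith
  transmission v p mPos mNeg hpu hpv hc hpos hneg ht hmPos hmNeg h1 h2 := by
    rw [freeBoundary_neg] at hpu
    have := hu.transmission (-v) p mNeg mPos hpu (by rwa [freeBoundary_neg]) hc.neg
      (by rw [posPhase_neg]; exact hneg.neg) (by rw [negPhase_neg]; exact hpos.neg) ht.neg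
      (by rwa [posFun_neg]) (by rwa [negFun_neg]) h2 h1
    linarith

end Neg

/-! ### Improvement of flatness -/

theorem cyl_mono {x₀ : EuclideanSpace ℝ (Fin n)} {t₀ r s : ℝ} (hr : 0 ≤ r) (h : r ≤ s) :
    cyl x₀ t₀ r ⊆ cyl x₀ t₀ s := by
  have : r ^ 2 ≤ s ^ 2 := by gcongr
  exact prod_mono (Metric.ball_subset_ball h) (Ioc_subset_Ioc_left (by linarith))

theorem dilate_mem_cyl {x₀ y : EuclideanSpace ℝ (Fin n)} {t₀ r τ : ℝ} (hr : 0 < r)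
    {q : SpaceTime n} (h1 : ‖y‖ + ‖q.1‖ < 1) (h2 : -1 < τ + q.2) (h3 : τ + q.2 ≤ 0) :
    dilate (x₀ + r • y) (t₀ + r ^ 2 * τ) r q ∈ cyl x₀ t₀ r := by
  have hr2 : 0 < r ^ 2 := by positivity
  refine ⟨?_, ?_, ?_⟩
  · rw [mem_ball_iff_norm]
    have : (dilate (x₀ + r • y) (t₀ + r ^ 2 * τ) r q).1 - x₀ = r • (y + q.1) := by
      simp only [dilate, smul_add]; abel
    rw [this, norm_smul, Real.norm_of_nonneg hr.le]
    nlinarith [norm_add_le y q.1]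
  · simp only [dilate]; nlinarith
  · simp only [dilate]; nlinarith

/-- The normalized height of `u` over the affine function `⟪e, x⟫ + A`, in rescaled variables. -/
def height (u : SpaceTime n → ℝ) (e : EuclideanSpace ℝ (Fin n)) (A h : ℝ)
    (y₀ : EuclideanSpace ℝ (Fin n)) (t₁ r : ℝ) (q : SpaceTime n) : ℝ :=
  (u (dilate y₀ t₁ r q) - inner ℝ e (dilate y₀ t₁ r q).1 - A) / h

theorem le_height_iff {u : SpaceTime n → ℝ} {e : EuclideanSpace ℝ (Fin n)} {A h : ℝ}
    {y₀ : EuclideanSpace ℝ (Fin n)} {t₁ r : ℝ} {q : SpaceTime n} (hh : 0 < h) {m : ℝ} :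
    m ≤ height u e A h y₀ t₁ r q ↔
      inner ℝ e (dilate y₀ t₁ r q).1 + A + h * m ≤ u (dilate y₀ t₁ r q) := by
  rw [height, le_div_iff₀ hh]
  constructor <;> intro h' <;> linarith

theorem continuousOn_height {u : SpaceTime n → ℝ} {e : EuclideanSpace ℝ (Fin n)} {A h : ℝ}
    {y₀ : EuclideanSpace ℝ (Fin n)} {t₁ r : ℝ} {Q K : Set (SpaceTime n)} (hu : ContinuousOn u Q)
    (hK : ∀ q ∈ K, dilate y₀ t₁ r q ∈ Q) : ContinuousOn (height u e A h y₀ t₁ r) K := by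
  have h1 : ContinuousOn (fun q => u (dilate y₀ t₁ r q)) K :=
    hu.comp continuous_dilate.continuousOn hK
  have h2 : Continuous fun q : SpaceTime n => inner ℝ e (dilate y₀ t₁ r q).1 :=
    continuous_const.inner (continuous_fst.comp continuous_dilate)
  exact ((h1.sub h2.continuousOn).sub continuousOn_const).div_const h

theorem integral_tent_pos {d ρ : ℝ} (hρ : 0 < ρ) (hρd : ρ ≤ d) :
    0 < ∫ y : EuclideanSpace ℝ (Fin n) in Metric.closedBall 0 d, tent ρ y := by
  have hi : MeasureTheory.IntegrableOn (tent ρ : EuclideanSpace ℝ (Fin n) → ℝ)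
      (Metric.closedBall 0 d) :=
    (continuous_tent ρ).continuousOn.integrableOn_compact (isCompact_closedBall _ _)
  refine (MeasureTheory.setIntegral_pos_iff_support_of_nonneg_ae
    (Eventually.of_forall (tent_nonneg ρ)) hi).2 ?_
  refine (Metric.measure_ball_pos MeasureTheory.volume (0 : EuclideanSpace ℝ (Fin n)) hρ).trans_le
    (MeasureTheory.measure_mono fun y hy => ?_)
  rw [mem_ball_zero_iff] at hy
  refine ⟨ne_of_gt (lt_max_of_lt_right (by linarith)), mem_closedBall_zero_iff.2 (by linarith)⟩

/-- If the height of a supersolution over an affine function is at least `1/2` on average, on a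
ball at some early time near which the supersolution does not vanish, then it is bounded below in
the smaller cylinder. -/
theorem IsViscositySupersolution.exists_improvement (n : ℕ) {aMin aMax a : ℝ} (haMin : 0 < aMin)
    (ha : 0 < a) :
    ∃ T > 0, T ≤ 1 / 4 ∧ ∃ c > 0, ∀ aPos ∈ Icc aMin aMax, ∀ aNeg ∈ Icc aMin aMax,
      ∀ {X : EuclideanSpace ℝ (Fin n)} {t R : ℝ} {u : SpaceTime n → ℝ},
      IsViscositySupersolution aPos aNeg (cyl X t R) u →
      ∀ {x₀ e e' : EuclideanSpace ℝ (Fin n)} {t₀ r A h : ℝ}, 0 < r → 0 < h → h ≤ r / 100 →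
      ‖e‖ = 1 → ‖e'‖ = 1 → cyl x₀ t₀ r ⊆ cyl X t R →
      (∀ p ∈ cyl x₀ t₀ r, inner ℝ e p.1 + A ≤ u p ∧ u p ≤ inner ℝ e p.1 + A + h) →
      ((a = aPos ∧ ∀ p ∈ cyl x₀ t₀ r,
          ‖p.1 - (x₀ + r • (1 / 10 : ℝ) • e')‖ ≤ r / 20 → 0 < u p) ∨
        (a = aNeg ∧ ∀ p ∈ cyl x₀ t₀ r,
          ‖p.1 - (x₀ + r • (1 / 10 : ℝ) • e')‖ ≤ r / 20 → u p < 0)) →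
      (∫ y : EuclideanSpace ℝ (Fin n) in Metric.closedBall 0 (1 / 20), tent (1 / 20 / 8) y) / 2 ≤
        ∫ y in Metric.closedBall 0 (1 / 20), tent (1 / 20 / 8) y *
          height u e A h (x₀ + r • (1 / 10 : ℝ) • e') (t₀ + r ^ 2 * -(1 / 2 + T)) r (y, 0) →
      ∀ p ∈ cyl x₀ t₀ (r / 3), inner ℝ e p.1 + A + h * c ≤ u p := by
  obtain ⟨T, hT, hT4, m, hm, hker⟩ := exists_heatComparison_lower_bound n ha
    (d := 1 / 20) (by norm_num) (by norm_num)
  obtain ⟨c, hc, hspread⟩ := IsViscositySupersolution.exists_spread n (aMax := aMax)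
    (ρ := 1 / 20 / 8) haMin (by norm_num) (by norm_num)
  have hI : 0 < ∫ y : EuclideanSpace ℝ (Fin n) in Metric.closedBall 0 (1 / 20),
    tent (1 / 20 / 8) y := integral_tent_pos (by norm_num) (by norm_num)
  set I := ∫ y : EuclideanSpace ℝ (Fin n) in Metric.closedBall 0 (1 / 20), tent (1 / 20 / 8) y
  refine ⟨T, hT, hT4, c * (m * (I / 2)), by positivity, ?_⟩
  intro aPos hPos aNeg hNeg X t R u hu x₀ e e' t₀ r A h hr hh hhr he he' hQ hu01 hsign hmass p hp
  have hy : ‖(1 / 10 : ℝ) • e'‖ = 1 / 10 := by rw [norm_smul, he']; norm_num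
  set y₀ := x₀ + r • (1 / 10 : ℝ) • e' with hy₀
  set t₁ := t₀ + r ^ 2 * -(1 / 2 + T) with ht₁
  set K : Set (SpaceTime n) := Metric.closedBall 0 (1 / 20) ×ˢ Icc 0 T with hK
  have hKc : IsCompact K := (isCompact_closedBall _ _).prod isCompact_Icc
  have hKcyl : ∀ q ∈ K, dilate y₀ t₁ r q ∈ cyl x₀ t₀ r := fun q hq => by
    have h1 : ‖q.1‖ ≤ 1 / 20 := mem_closedBall_zero_iff.1 hq.1
    exact dilate_mem_cyl hr (by rw [hy]; linarith) (by linarith [hq.2.1]) (by linarith [hq.2.2])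
  have hKball : ∀ q ∈ K, ‖(dilate y₀ t₁ r q).1 - y₀‖ ≤ r / 20 := fun q hq => by
    have h1 : ‖q.1‖ ≤ 1 / 20 := mem_closedBall_zero_iff.1 hq.1
    simp only [dilate, add_sub_cancel_left, norm_smul, Real.norm_of_nonneg hr.le]
    nlinarith
  set w := height u e A h y₀ t₁ r with hw
  have hw0 : ∀ q ∈ K, 0 ≤ w q := fun q hq => by
    rw [hw, le_height_iff hh, mul_zero, add_zero]
    exact (hu01 _ (hKcyl q hq)).1
  have hcomp : HeatComparison a (1 / 20) T w := by
    intro g hg hgs hgb q hq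
    rw [hw, le_height_iff hh]
    refine hu.ge_rescaled hr hh hKc (fun q hq => hQ (hKcyl q hq)) hg (fun q hq => ?_) q hq
    by_cases hb : ‖q.1‖ = 1 / 20 ∨ q.2 = 0
    · exact Or.inl ((le_height_iff hh).1 (hgb q hq hb))
    · rw [not_or] at hb
      have h1 : ‖q.1‖ < 1 / 20 := lt_of_le_of_ne (mem_closedBall_zero_iff.1 hq.1) hb.1
      have h2 : 0 < q.2 := lt_of_le_of_ne hq.2.1 (Ne.symm hb.2)
      have hq1 := hKcyl q hq
      have hq2 := hKball q hq
      refine Or.inr ⟨?_, fun h0 => ?_, fun h0 => ?_, fun h0 => ?_⟩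
      · obtain ⟨ρ₁, hρ₁, hsub⟩ := exists_cyl_subset (q := q)
          (((isOpen_lt (continuous_norm.comp continuous_fst) continuous_const).inter
            (isOpen_lt continuous_const continuous_snd)).mem_nhds ⟨h1, h2⟩)
        exact ⟨ρ₁, hρ₁, fun z hz => ⟨mem_closedBall_zero_iff.2 (le_of_lt (hsub z hz).1.1),
          le_of_lt (hsub z hz).1.2, (hsub z hz).2.trans hq.2.2⟩⟩
      · rcases hsign with ⟨rfl, -⟩ | ⟨-, hs⟩
        · exact hgs q h2
        · exact absurd (hs _ hq1 hq2) (not_lt.2 h0.le)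
      · rcases hsign with ⟨-, hs⟩ | ⟨rfl, -⟩
        · exact absurd (hs _ hq1 hq2) (not_lt.2 h0.le)
        · exact hgs q h2
      · rcases hsign with ⟨-, hs⟩ | ⟨-, hs⟩
        · exact absurd h0 (hs _ hq1 hq2).ne'
        · exact absurd h0 (hs _ hq1 hq2).ne
  have hlow := hker w (continuousOn_height hu.continuousOn fun q hq => hQ (hKcyl q hq)) hw0 hcomp
  have hmJ : m * (I / 2) ≤ m * ∫ y in Metric.closedBall 0 (1 / 20), tent (1 / 20 / 8) y * w (y, 0) :=
    mul_le_mul_of_nonneg_left hmass hm.le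
  have hTK : ((0 : EuclideanSpace ℝ (Fin n)), T) ∈ K :=
    ⟨by simp, right_mem_Icc.2 hT.le⟩
  -- The barrier needs a height of at most 1, which the upper bound on `u` provides.
  have hm1 : m * (I / 2) ≤ 1 := by
    have h1 := hmJ.trans (hlow 0 (by rw [norm_zero]; norm_num))
    rw [hw, le_height_iff hh] at h1
    have h2 := (hu01 _ (hKcyl _ hTK)).2
    have h3 : h * (m * (I / 2)) ≤ h * 1 := by linarith
    exact le_of_mul_le_mul_left h3 hh
  -- The end of the heat-kernel stage is the start of the barrier stage. The barrier's final time
  -- `1/2` is then `t₀`; its target radius is `13/30 = 1/3 + 1/10`, and its target times start at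
  -- `7/18 = 1/2 - 1/9`.
  set t₂ := t₀ + r ^ 2 * -(1 / 2) with ht₂
  have htime : ∀ z, dilate y₀ t₂ r (z, 0) = dilate y₀ t₁ r (z, T) := fun z => by
    ext1
    · rfl
    · simp only [dilate, ht₁, ht₂]; ring
  have hfinal := hspread aPos hPos aNeg hNeg hu (y₀ := y₀) (e := e) (t₁ := t₂) (A := A)
    (m := m * (I / 2)) hr hh hhr he (by positivity) hm1
    (fun q hq1 hq2 => by
      have h1 : dilate y₀ t₂ r q ∈ cyl x₀ t₀ r :=
        dilate_mem_cyl hr (by rw [hy]; linarith) (by linarith [hq2.1]) (by linarith [hq2.2])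
      exact ⟨hQ h1, (hu01 _ h1).1⟩)
    (fun z hz => by
      rw [htime, ← le_height_iff hh]
      exact hmJ.trans (hlow z hz))
    (undilate y₀ t₂ r p)
    (by
      have h1 : ‖p.1 - x₀‖ < r / 3 := mem_ball_iff_norm.1 hp.1
      have h2 : ‖p.1 - y₀‖ ≤ r * (13 / 30) := by
        have h3 : p.1 - y₀ = (p.1 - x₀) - r • (1 / 10 : ℝ) • e' := by rw [hy₀]; abel
        have h4 : ‖r • (1 / 10 : ℝ) • e'‖ = r * (1 / 10) := by
          rw [norm_smul, hy, Real.norm_of_nonneg hr.le]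
        rw [h3]
        linarith [norm_sub_le (p.1 - x₀) (r • (1 / 10 : ℝ) • e')]
      simp only [undilate, norm_smul, norm_inv, Real.norm_of_nonneg hr.le]
      rwa [inv_mul_le_iff₀ hr])
    (by
      have hr2 : 0 < r ^ 2 := by positivity
      obtain ⟨h1, h2⟩ := hp.2
      simp only [undilate, ht₂]
      constructor
      · rw [le_div_iff₀ hr2]; nlinarith
      · rw [div_le_iff₀ hr2]; nlinarith)
  rwa [dilate_undilate hr] at hfinal

/-- Under the sign condition of `exists_improvement`, either the lower or the upper bound of a
viscosity solution improves. -/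
theorem IsViscositySolution.exists_dichotomy (n : ℕ) {aPos aNeg a : ℝ} (hPos : 0 < aPos)
    (hNeg : 0 < aNeg) (ha : 0 < a) :
    ∃ c > 0, ∀ {X : EuclideanSpace ℝ (Fin n)} {t R : ℝ} {u : SpaceTime n → ℝ},
      IsViscositySolution aPos aNeg (cyl X t R) u →
      ∀ {x₀ e e' : EuclideanSpace ℝ (Fin n)} {t₀ r A h : ℝ}, 0 < r → 0 < h → h ≤ r / 100 →
      ‖e‖ = 1 → ‖e'‖ = 1 → cyl x₀ t₀ r ⊆ cyl X t R →
      (∀ p ∈ cyl x₀ t₀ r, inner ℝ e p.1 + A ≤ u p ∧ u p ≤ inner ℝ e p.1 + A + h) →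
      ((a = aPos ∧ ∀ p ∈ cyl x₀ t₀ r,
          ‖p.1 - (x₀ + r • (1 / 10 : ℝ) • e')‖ ≤ r / 20 → 0 < u p) ∨
        (a = aNeg ∧ ∀ p ∈ cyl x₀ t₀ r,
          ‖p.1 - (x₀ + r • (1 / 10 : ℝ) • e')‖ ≤ r / 20 → u p < 0)) →
      (∀ p ∈ cyl x₀ t₀ (r / 3), inner ℝ e p.1 + A + h * c ≤ u p) ∨
        (∀ p ∈ cyl x₀ t₀ (r / 3), u p ≤ inner ℝ e p.1 + A + h - h * c) := by
  obtain ⟨T, hT, hT4, c, hc, himp⟩ := IsViscositySupersolution.exists_improvement n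
    (aMin := min aPos aNeg) (aMax := max aPos aNeg) (lt_min hPos hNeg) ha
  have hP : aPos ∈ Icc (min aPos aNeg) (max aPos aNeg) := ⟨min_le_left _ _, le_max_left _ _⟩
  have hN : aNeg ∈ Icc (min aPos aNeg) (max aPos aNeg) := ⟨min_le_right _ _, le_max_right _ _⟩
  refine ⟨c, hc, ?_⟩
  intro X t R u hu x₀ e e' t₀ r A h hr hh hhr he he' hQ hu01 hsign
  set y₀ := x₀ + r • (1 / 10 : ℝ) • e' with hy₀
  set t₁ := t₀ + r ^ 2 * -(1 / 2 + T) with ht₁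
  -- The two heights add up to 1, so one of `u` and `-u` has weighted mean at least half of the
  -- tent's integral.
  have hheight : ∀ q, height (-u) (-e) (-(A + h)) h y₀ t₁ r q = 1 - height u e A h y₀ t₁ r q :=
    fun q => by
      simp only [height, Pi.neg_apply, inner_neg_left]
      field_simp
      ring
  have hyn : ‖(1 / 10 : ℝ) • e'‖ = 1 / 10 := by rw [norm_smul, he']; norm_num
  have hwc : ContinuousOn (fun y : EuclideanSpace ℝ (Fin n) => height u e A h y₀ t₁ r (y, 0))
      (Metric.closedBall 0 (1 / 20)) := by
    have h1 : ContinuousOn (height u e A h y₀ t₁ r) (Metric.closedBall 0 (1 / 20) ×ˢ {0}) :=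
      continuousOn_height hu.1.continuousOn fun q hq => hQ (by
        have h2 : ‖q.1‖ ≤ 1 / 20 := mem_closedBall_zero_iff.1 hq.1
        have h3 : q.2 = 0 := hq.2
        exact dilate_mem_cyl hr (by rw [hyn]; linarith) (by linarith) (by linarith))
    exact h1.comp (Continuous.prodMk_left (0 : ℝ)).continuousOn fun y hy => ⟨hy, rfl⟩
  have hcb : IsCompact (Metric.closedBall (0 : EuclideanSpace ℝ (Fin n)) (1 / 20)) :=
    isCompact_closedBall _ _
  have hi1 : MeasureTheory.IntegrableOn (tent (1 / 20 / 8) : EuclideanSpace ℝ (Fin n) → ℝ)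
      (Metric.closedBall 0 (1 / 20)) := (continuous_tent _).continuousOn.integrableOn_compact hcb
  have hi2 : MeasureTheory.IntegrableOn (fun y : EuclideanSpace ℝ (Fin n) =>
      tent (1 / 20 / 8) y * height u e A h y₀ t₁ r (y, 0)) (Metric.closedBall 0 (1 / 20)) :=
    ((continuous_tent _).continuousOn.mul hwc).integrableOn_compact hcb
  have hsum : ∫ y in Metric.closedBall 0 (1 / 20), tent (1 / 20 / 8) y *
        height (-u) (-e) (-(A + h)) h y₀ t₁ r (y, 0) =
      (∫ y : EuclideanSpace ℝ (Fin n) in Metric.closedBall 0 (1 / 20), tent (1 / 20 / 8) y) -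
        ∫ y in Metric.closedBall 0 (1 / 20), tent (1 / 20 / 8) y *
          height u e A h y₀ t₁ r (y, 0) := by
    rw [← MeasureTheory.integral_sub hi1 hi2]
    simp only [hheight]
    congr 1
    funext y
    ring
  rcases le_total ((∫ y : EuclideanSpace ℝ (Fin n) in Metric.closedBall 0 (1 / 20),
      tent (1 / 20 / 8) y) / 2) (∫ y in Metric.closedBall 0 (1 / 20), tent (1 / 20 / 8) y *
        height u e A h y₀ t₁ r (y, 0)) with hm | hm
  · exact Or.inl (himp aPos hP aNeg hN hu.2 hr hh hhr he he' hQ hu01 hsign hm)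
  · right
    intro p hp
    have h1 := himp aNeg hN aPos hP hu.1.supersolution_neg (e := -e) (A := -(A + h)) hr hh hhr
      (by rwa [norm_neg]) he' hQ
      (fun p hp => by
        have := hu01 p hp
        simp only [Pi.neg_apply, inner_neg_left]
        constructor <;> linarith)
      (by
        simp only [Pi.neg_apply, Left.neg_pos_iff, Left.neg_neg_iff]
        exact hsign.symm)
      (by rw [hsum]; linarith) p hp
    simp only [Pi.neg_apply, inner_neg_left] at h1
    linarith

/-! ### The Harnack inequality -/

theorem IsViscositySolution.exists_harnack (n : ℕ) {aPos aNeg : ℝ} (hPos : 0 < aPos)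
    (hNeg : 0 < aNeg) :
    ∃ c : ℝ, 0 < c ∧ c < 1 ∧ ∀ {X : EuclideanSpace ℝ (Fin (n + 1))} {t R : ℝ}
      {u : SpaceTime (n + 1) → ℝ}, IsViscositySolution aPos aNeg (cyl X t R) u →
      ∀ {x₀ : EuclideanSpace ℝ (Fin (n + 1))} {t₀ r α₀ β₀ : ℝ}, 0 < r →
        cyl x₀ t₀ r ⊆ cyl X t R → 0 < β₀ - α₀ → β₀ - α₀ ≤ r / 100 →
        (∀ p ∈ cyl x₀ t₀ r, lastCoord p + α₀ ≤ u p ∧ u p ≤ lastCoord p + β₀) →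
        ∃ α₁ β₁ : ℝ, α₀ ≤ α₁ ∧ α₁ ≤ β₁ ∧ β₁ ≤ β₀ ∧ β₁ - α₁ ≤ c * (β₀ - α₀) ∧
          ∀ p ∈ cyl x₀ t₀ (r / 3), lastCoord p + α₁ ≤ u p ∧ u p ≤ lastCoord p + β₁ := by
  obtain ⟨c₁, hc₁, h₁⟩ := IsViscositySolution.exists_dichotomy (n + 1) hPos hNeg hPos
  obtain ⟨c₂, hc₂, h₂⟩ := IsViscositySolution.exists_dichotomy (n + 1) hPos hNeg hNeg
  -- The cap `1/2` keeps the improved bounds in the right order.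
  set c := min (min c₁ c₂) (1 / 2) with hc
  have hc0 : 0 < c := by positivity
  have hcc₁ : c ≤ c₁ := (min_le_left _ _).trans (min_le_left _ _)
  have hcc₂ : c ≤ c₂ := (min_le_left _ _).trans (min_le_right _ _)
  have hc2 : c ≤ 1 / 2 := min_le_right _ _
  refine ⟨1 - c, by linarith, by linarith, ?_⟩
  intro X t R u hu x₀ t₀ r α₀ β₀ hr hQ hh hhr hu01
  set h := β₀ - α₀ with hhdef
  set e : EuclideanSpace ℝ (Fin (n + 1)) := EuclideanSpace.single (Fin.last n) 1 with he
  have hen : ‖e‖ = 1 := by simp [he]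
  have hlast : ∀ p : SpaceTime (n + 1), lastCoord p = inner ℝ e p.1 := fun p => by
    simp [lastCoord, he, EuclideanSpace.inner_single_left]
  simp only [hlast] at hu01 ⊢
  have hu01' : ∀ p ∈ cyl x₀ t₀ r, inner ℝ e p.1 + α₀ ≤ u p ∧ u p ≤ inner ℝ e p.1 + α₀ + h :=
    fun p hp => ⟨(hu01 p hp).1, by linarith [(hu01 p hp).2]⟩
  have key : (∀ p ∈ cyl x₀ t₀ (r / 3), inner ℝ e p.1 + α₀ + h * c ≤ u p) ∨
      (∀ p ∈ cyl x₀ t₀ (r / 3), u p ≤ inner ℝ e p.1 + α₀ + h - h * c) := by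
    have hhc₁ : h * c ≤ h * c₁ := by gcongr
    have hhc₂ : h * c ≤ h * c₂ := by gcongr
    -- the height of `x_n` near the two points `x₀ ± (r / 10) e_n`
    have hinner : ∀ (s : ℝ) (p : SpaceTime (n + 1)),
        ‖p.1 - (x₀ + r • (1 / 10 : ℝ) • (s • e))‖ ≤ r / 20 →
        |inner ℝ e p.1 - inner ℝ e x₀ - s * (r / 10)| ≤ r / 20 := fun s p hp => by
      have e1 := abs_real_inner_le_norm e (p.1 - (x₀ + r • (1 / 10 : ℝ) • (s • e)))
      rw [hen, one_mul] at e1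
      replace e1 := e1.trans hp
      rw [inner_sub_right, inner_add_right, inner_smul_right, inner_smul_right, inner_smul_right,
        real_inner_self_eq_norm_sq, hen] at e1
      have e2 : inner ℝ e p.1 - inner ℝ e x₀ - s * (r / 10) =
          inner ℝ e p.1 - (inner ℝ e x₀ + r * (1 / 10 * (s * 1 ^ 2))) := by ring
      rwa [e2]
    -- The auxiliary ball lies at height at least `r/20` above or below `x₀` in the direction `e_n`.
    -- This outweighs both `r/200` and, on the negative side, the width `h ≤ r/100`, so the sign of
    -- `u` is fixed there.
    rcases le_total (-(r / 200)) (inner ℝ e x₀ + α₀) with hs | hs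
    · refine (h₁ hu hr hh hhr hen (e' := (1 : ℝ) • e) (by rwa [one_smul]) hQ hu01'
        (Or.inl ⟨rfl, fun p hp hpn => ?_⟩)).imp (fun H p hp => ?_) fun H p hp => ?_
      · have := abs_le.1 (hinner 1 p hpn)
        linarith [(hu01' p hp).1]
      · linarith [H p hp]
      · linarith [H p hp]
    · refine (h₂ hu hr hh hhr hen (e' := (-1 : ℝ) • e) (by rw [norm_smul, hen]; norm_num) hQ hu01'
        (Or.inr ⟨rfl, fun p hp hpn => ?_⟩)).imp (fun H p hp => ?_) fun H p hp => ?_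
      · have := abs_le.1 (hinner (-1) p hpn)
        linarith [(hu01' p hp).2]
      · linarith [H p hp]
      · linarith [H p hp]
  have hhc : 0 < h * c := by positivity
  have hhc2 : h * c ≤ h * (1 / 2) := by gcongr
  have hsub : cyl x₀ t₀ (r / 3) ⊆ cyl x₀ t₀ r := cyl_mono (by positivity) (by linarith)
  rcases key with H | H
  · exact ⟨α₀ + h * c, β₀, by linarith, by linarith, le_rfl, by linarith, fun p hp =>
      ⟨by linarith [H p hp], (hu01 p (hsub hp)).2⟩⟩
  · exact ⟨α₀, β₀ - h * c, le_rfl, by linarith, by linarith, by linarith, fun p hp =>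
      ⟨(hu01 p (hsub hp)).1, by linarith [H p hp]⟩⟩

/-! ### Hölder continuity at intermediate scales -/

theorem cyl_half_subset {p₀ : SpaceTime n}
    (hp₀ : p₀ ∈ cyl (0 : EuclideanSpace ℝ (Fin n)) 0 (1 / 2)) :
    cyl p₀.1 p₀.2 (1 / 2) ⊆ cyl 0 0 1 := by
  rintro p ⟨h1, h2, h3⟩
  obtain ⟨h4, h5, h6⟩ := hp₀
  rw [mem_ball_zero_iff] at h4
  rw [mem_ball_iff_norm] at h1
  refine ⟨mem_ball_zero_iff.2 ?_, by linarith, h3.trans h6⟩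
  linarith [norm_le_insert' p.1 p₀.1]

/-- Iterated Harnack inequality: geometric decay of the oscillation of `u - x_n`. -/
theorem exists_oscillation_decay {c : ℝ} (hc0 : 0 < c) (hc1 : c < 1)
    {u : SpaceTime (n + 1) → ℝ} {p₀ : SpaceTime (n + 1)}
    (hstep : ∀ {r α₀ β₀ : ℝ}, 0 < r → r ≤ 1 / 2 → 0 < β₀ - α₀ → β₀ - α₀ ≤ r / 100 →
      (∀ p ∈ cyl p₀.1 p₀.2 r, lastCoord p + α₀ ≤ u p ∧ u p ≤ lastCoord p + β₀) →
      ∃ α₁ β₁ : ℝ, α₀ ≤ α₁ ∧ α₁ ≤ β₁ ∧ β₁ ≤ β₀ ∧ β₁ - α₁ ≤ c * (β₀ - α₀) ∧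
        ∀ p ∈ cyl p₀.1 p₀.2 (r / 3), lastCoord p + α₁ ≤ u p ∧ u p ≤ lastCoord p + β₁)
    {δ : ℝ} (hδ : 0 < δ)
    (hu : ∀ p ∈ cyl p₀.1 p₀.2 (1 / 2), lastCoord p - δ ≤ u p ∧ u p ≤ lastCoord p + δ) (k : ℕ)
    (hk : 2 * δ ≤ (1 / 3) ^ k / 2 / 100) :
    ∃ α β : ℝ, β - α ≤ 2 * δ * c ^ k ∧ ∀ p ∈ cyl p₀.1 p₀.2 ((1 / 3) ^ k / 2),
      lastCoord p + α ≤ u p ∧ u p ≤ lastCoord p + β := by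
  induction k with
  | zero =>
    refine ⟨-δ, δ, by rw [pow_zero]; linarith, fun p hp => ?_⟩
    rw [pow_zero] at hp
    exact ⟨by linarith [(hu p hp).1], (hu p hp).2⟩
  | succ k ih =>
    have hpow : (0 : ℝ) < (1 / 3) ^ k := by positivity
    have hpow1 : (1 / 3 : ℝ) ^ k ≤ 1 := pow_le_one₀ (by norm_num) (by norm_num)
    have hrad : (1 / 3 : ℝ) ^ (k + 1) / 2 = (1 / 3) ^ k / 2 / 3 := by rw [pow_succ]; ring
    obtain ⟨α, β, hαβ, hb⟩ := ih (by rw [hrad] at hk; linarith)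
    have hsub : cyl p₀.1 p₀.2 ((1 / 3) ^ k / 2 / 3) ⊆ cyl p₀.1 p₀.2 ((1 / 3) ^ k / 2) :=
      cyl_mono (by positivity) (by linarith)
    have hck : c ^ k ≤ 1 := pow_le_one₀ hc0.le hc1.le
    have hck0 : 0 < c ^ k := by positivity
    rw [hrad]
    -- The Harnack step needs a positive width; with zero or negative width the old bounds already
    -- suffice.
    rcases le_or_gt (β - α) 0 with h0 | h0
    · exact ⟨α, β, h0.trans (by positivity), fun p hp => hb p (hsub hp)⟩
    · obtain ⟨α₁, β₁, -, -, -, h1, h2⟩ := hstep (by positivity) (by linarith) h0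
        (by rw [hrad] at hk; nlinarith) hb
      refine ⟨α₁, β₁, h1.trans ?_, h2⟩
      calc c * (β - α) ≤ c * (2 * δ * c ^ k) := by gcongr
        _ = 2 * δ * c ^ (k + 1) := by ring

theorem mem_cyl_of_parabolicDist_lt {p p₀ : SpaceTime n} {r : ℝ} (h : parabolicDist p p₀ < r)
    (ht : p.2 ≤ p₀.2) : p ∈ cyl p₀.1 p₀.2 r := by
  have hr : 0 < r := (Real.sqrt_nonneg _).trans_lt h
  have h1 := (Real.sqrt_lt' hr).1 h
  have h2 := neg_abs_le (p.2 - p₀.2)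
  refine ⟨mem_ball_iff_norm.2 ?_, by nlinarith [sq_nonneg ‖p.1 - p₀.1‖], ht⟩
  exact lt_of_pow_lt_pow_left₀ 2 hr.le (by linarith [abs_nonneg (p.2 - p₀.2)])

/-- The exponent is defined by `(1/3)^γ = c`, and `c > 1/3` is what makes it smaller than 1. The
shift from `k` to `k + 2` costs the factor `c⁻²`. -/
theorem exists_hoelder_of_decay {c : ℝ} (hc : 1 / 3 < c) (hc1 : c < 1) :
    ∃ C γ : ℝ, 0 < C ∧ 0 < γ ∧ γ < 1 ∧ ∀ d : ℝ, 0 < d → ∀ k : ℕ,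
      (1 / 3) ^ (k + 2) ≤ 2 * d → 2 * c ^ k ≤ C * d ^ γ := by
  have hc0 : 0 < c := by linarith
  have h3 : Real.log (1 / 3) < 0 := Real.log_neg (by norm_num) (by norm_num)
  have hlc : Real.log c < 0 := Real.log_neg hc0 hc1
  have hlt : Real.log (1 / 3) < Real.log c := Real.log_lt_log (by norm_num) hc
  set γ := Real.log c / Real.log (1 / 3) with hγ
  have hγ0 : 0 < γ := div_pos_of_neg_of_neg hlc h3
  have hcγ : (1 / 3 : ℝ) ^ γ = c := by
    rw [Real.rpow_def_of_pos (by norm_num), hγ, mul_div_cancel₀ _ h3.ne, Real.exp_log hc0]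
  refine ⟨2 / c ^ 2 * 2 ^ γ, γ, by positivity, hγ0, ?_, fun d hd k hk => ?_⟩
  · rw [hγ, div_lt_one_of_neg h3]; exact hlt
  · have h1 : c ^ (k + 2) ≤ (2 * d) ^ γ := by
      calc c ^ (k + 2) = ((1 / 3 : ℝ) ^ (k + 2)) ^ γ := by
            rw [← hcγ, ← Real.rpow_natCast, ← Real.rpow_natCast, ← Real.rpow_mul (by norm_num),
              ← Real.rpow_mul (by norm_num), mul_comm]
        _ ≤ (2 * d) ^ γ := Real.rpow_le_rpow (by positivity) hk hγ0.le
    rw [Real.mul_rpow (by norm_num) hd.le] at h1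
    calc 2 * c ^ k = 2 / c ^ 2 * c ^ (k + 2) := by rw [pow_add]; field_simp
      _ ≤ 2 / c ^ 2 * (2 ^ γ * d ^ γ) := by gcongr
      _ = 2 / c ^ 2 * 2 ^ γ * d ^ γ := by ring

end FreeTransmission

end

theorem theorem3p3 :
    ∃ δ₀ : ℝ, 0 < δ₀ ∧
      -- the space dimension is `n + 1 ≥ 1`
      ∀ (n : ℕ) (aPos aNeg : ℝ), 0 < aPos → 0 < aNeg → aPos ≠ aNeg →
        -- Harnack inequality
        (∃ c : ℝ, 0 < c ∧ c < 1 ∧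
          ∀ u : FreeTransmission.SpaceTime (n + 1) → ℝ,
            FreeTransmission.IsViscositySolution aPos aNeg (FreeTransmission.cyl 0 0 1) u →
            ∀ (x₀ : EuclideanSpace ℝ (Fin (n + 1))) (t₀ r α₀ β₀ δ : ℝ),
              (x₀, t₀) ∈ FreeTransmission.cyl (0 : EuclideanSpace ℝ (Fin (n + 1))) 0 (1 / 2) →
              0 < r →
              FreeTransmission.cyl x₀ t₀ r ⊆ FreeTransmission.cyl 0 0 1 →
              0 < β₀ - α₀ → β₀ - α₀ ≤ δ * r → 0 < δ → δ ≤ δ₀ →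
              (∀ p ∈ FreeTransmission.cyl x₀ t₀ r,
                FreeTransmission.lastCoord p + α₀ ≤ u p ∧
                  u p ≤ FreeTransmission.lastCoord p + β₀) →
              ∃ α₁ β₁ : ℝ, α₀ ≤ α₁ ∧ α₁ ≤ β₁ ∧ β₁ ≤ β₀ ∧ β₁ - α₁ ≤ c * δ * r ∧
                ∀ p ∈ FreeTransmission.cyl x₀ t₀ (r / 3),
                  FreeTransmission.lastCoord p + α₁ ≤ u p ∧
                    u p ≤ FreeTransmission.lastCoord p + β₁) ∧
        -- Hölder continuity of `(u - x_n) / δ` down to scale `2 δ / δ₀`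
        (∃ C γ : ℝ, 0 < C ∧ 0 < γ ∧ γ < 1 ∧
          ∀ u : FreeTransmission.SpaceTime (n + 1) → ℝ,
            FreeTransmission.IsViscositySolution aPos aNeg (FreeTransmission.cyl 0 0 1) u →
            ∀ δ : ℝ, 0 < δ → δ ≤ δ₀ / 4 →
              (∀ p ∈ FreeTransmission.cyl (0 : EuclideanSpace ℝ (Fin (n + 1))) 0 1,
                FreeTransmission.lastCoord p - δ ≤ u p ∧
                  u p ≤ FreeTransmission.lastCoord p + δ) →
              ∀ p₀ ∈ FreeTransmission.cyl (0 : EuclideanSpace ℝ (Fin (n + 1))) 0 (1 / 2),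
                ∀ p ∈ FreeTransmission.cyl p₀.1 p₀.2 (1 / 2),
                  2 * δ / δ₀ ≤ FreeTransmission.parabolicDist p p₀ →
                  |(u p - FreeTransmission.lastCoord p) / δ -
                      (u p₀ - FreeTransmission.lastCoord p₀) / δ| ≤
                    C * FreeTransmission.parabolicDist p p₀ ^ γ) := by
  refine ⟨1 / 100, by norm_num, fun n aPos aNeg hPos hNeg _ => ?_⟩
  obtain ⟨c, hc0, hc1, hharnack⟩ :=
    FreeTransmission.IsViscositySolution.exists_harnack n hPos hNeg
  refine ⟨⟨c, hc0, hc1, fun u hu x₀ t₀ r α₀ β₀ δ _ hr hQ hh hhr _ hδ hb => ?_⟩, ?_⟩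
  · obtain ⟨α₁, β₁, h1, h2, h3, h4, h5⟩ := hharnack hu hr hQ hh (by nlinarith) hb
    exact ⟨α₁, β₁, h1, h2, h3, by nlinarith, h5⟩
  -- The contraction factor is raised to at least `1/2 > 1/3` so that the Hölder exponent stays
  -- below 1.
  · have hm1 : max c (1 / 2) < 1 := max_lt hc1 (by norm_num)
    have hm3 : 1 / 3 < max c (1 / 2) := lt_max_of_lt_right (by norm_num)
    obtain ⟨C, γ, hC, hγ0, hγ1, hCγ⟩ := FreeTransmission.exists_hoelder_of_decay hm3 hm1
    refine ⟨C, γ, hC, hγ0, hγ1, fun u hu δ hδ hδ0 hb p₀ hp₀ p hp hd => ?_⟩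
    set d := FreeTransmission.parabolicDist p p₀ with hddef
    have hsub := FreeTransmission.cyl_half_subset hp₀
    have hp₀p : ∀ r : ℝ, 0 < r → p₀ ∈ FreeTransmission.cyl p₀.1 p₀.2 r := fun r hr =>
      ⟨Metric.mem_ball_self hr, by nlinarith [sq_pos_of_pos hr], le_rfl⟩
    have hd' : 200 * δ ≤ d := by
      have : 2 * δ / (1 / 100) = 200 * δ := by ring
      linarith
    have hd0 : 0 < d := by linarith
    have habs : ∀ (α β : ℝ),
        (FreeTransmission.lastCoord p + α ≤ u p ∧ u p ≤ FreeTransmission.lastCoord p + β) →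
        (FreeTransmission.lastCoord p₀ + α ≤ u p₀ ∧ u p₀ ≤ FreeTransmission.lastCoord p₀ + β) →
        |(u p - FreeTransmission.lastCoord p) / δ -
          (u p₀ - FreeTransmission.lastCoord p₀) / δ| ≤ (β - α) / δ := fun α β h1 h2 => by
      rw [← sub_div, abs_div, abs_of_pos hδ]
      have : |u p - FreeTransmission.lastCoord p - (u p₀ - FreeTransmission.lastCoord p₀)| ≤
          β - α := abs_le.2 ⟨by linarith [h1.1, h2.2], by linarith [h1.2, h2.1]⟩
      gcongr
    have htriv : |(u p - FreeTransmission.lastCoord p) / δ -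
        (u p₀ - FreeTransmission.lastCoord p₀) / δ| ≤ 2 * max c (1 / 2) ^ 0 := by
      have h1 := hb p (hsub hp)
      have h2 := hb p₀ (hsub (hp₀p _ (by norm_num)))
      refine (habs (-δ) δ ⟨by linarith [h1.1], h1.2⟩ ⟨by linarith [h2.1], h2.2⟩).trans (le_of_eq ?_)
      field_simp
      ring
    by_cases hd1 : 1 / 9 ≤ 2 * d
    · exact htriv.trans (hCγ d hd0 0 (by norm_num; linarith))
    -- Here `(1/3)^(j+1) < 2d ≤ (1/3)^j`, and the decay is used with `k = j - 1`: one scale is given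
    -- up so that `d` is strictly below the radius `(1/3)^k / 2`. Together with `200 δ ≤ d` this
    -- also yields the flatness required up to step `k`.
    · obtain ⟨j, hj1, hj2⟩ := exists_nat_pow_near_of_lt_one (x := 2 * d) (y := (1 / 3 : ℝ))
        (by positivity) (by linarith) (by norm_num) (by norm_num)
      obtain _ | k := j
      · norm_num at hj1; linarith
      · have hpow : (0 : ℝ) < (1 / 3) ^ k := by positivity
        have hdk : d < (1 / 3) ^ k / 2 := by
          rw [pow_succ] at hj2; linarith
        obtain ⟨α, β, hαβ, hosc⟩ := FreeTransmission.exists_oscillation_decay (c := max c (1 / 2))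
          (by linarith) hm1 (u := u) (p₀ := p₀)
          (fun {r α₀ β₀} hr hr2 hh hhr hb' => by
            obtain ⟨α₁, β₁, h1, h2, h3, h4, h5⟩ := hharnack hu hr
              ((FreeTransmission.cyl_mono hr.le hr2).trans hsub) hh hhr hb'
            exact ⟨α₁, β₁, h1, h2, h3,
              h4.trans (mul_le_mul_of_nonneg_right (le_max_left _ _) hh.le), h5⟩)
          hδ (fun q hq => hb q (hsub hq)) k (by linarith)
        refine (habs α β
          (hosc p (FreeTransmission.mem_cyl_of_parabolicDist_lt hdk hp.2.2))
          (hosc p₀ (hp₀p _ (by positivity)))).trans ?_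
        refine le_trans ?_ (hCγ d hd0 k hj1.le)
        rw [div_le_iff₀ hδ]
        linarith
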